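/- Let $\Gamma$ be a group and let $\rho$ be a probability measure on $\Gamma$ whose support is finite and generates $\Gamma$ (so that $\Gamma$ is finitely generated), and which is symmetric: $\rho(g^{-1})=\rho(g)$ for all $g\in\Gamma$. Let $\Phi:\Gamma\to\mathrm{Homeo}_+(\mathbb R)$ be an action of $\Gamma$ on the real line by orientation-preserving homeomorphisms. A Radon (that is, locally finite Borel) measure $\nu$ on $\mathbb R$ is called stationary for $\Phi$ if $\nu=\sum_{g\in\Gamma}\rho(g)\,\Phi(g)_*\nu$. An action without global fixed points is called $\rho$-harmonic if Lebesgue measure is stationary for it. The action is called minimal if every orbit is dense, and an orbit is called discrete if it meets every compact interval in a finite set. Then: 1. There exists a nonzero stationary Radon measure for $\Phi$. 2. If $\Phi$ has no discrete orbit, then the nonzero stationary Radon measure is unique up to a scalar factor: if $\nu_1,\nu_2$ are nonzero stationary Radon measures for $\Phi$, then $\nu_2=c\,\nu_1$ for some $c>0$. 3. If $\Phi$ is minimal, then $\Phi$ is topologically conjugate to a $\rho$-harmonic action: there is an orientation-preserving homeomorphism $\varphi$ of $\mathbb R$ such that the action $g\mapsto\varphi\circ\Phi(g)\circ\varphi^{-1}$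 is $\rho$-harmonic. 4. If $\Phi$ is minimal, this conjugacy is unique up to post-composition with an affine map: if $\varphi$ is a homeomorphism of $\mathbb R$ such that $\varphi\circ\Phi\circ\varphi^{-1}$ is $\rho$-harmonic, then a homeomorphism $\varphi'$ of $\mathbb R$ has the property that $\varphi'\circ\Phi\circ\varphi'^{-1}$ is $\rho$-harmonic if and only if there are real numbers $a\neq 0$ and $b$ with $\varphi'(x)=a\,\varphi(x)+b$ for all $x\in\mathbb R$. -/

import Mathlib

open MeasureTheory
open scoped NNReal ENNReal

/-- `Homeo₊(ℝ)`: the group of orientation-preserving homeomorphisms of the real line, with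
composition `(f * g) x = f (g x)`. -/
def HomeoPlus : Subgroup (ℝ ≃ₜ ℝ) where
  carrier := {f | StrictMono f}
  mul_mem' := fun {_ _} hf hg _ _ hxy => hf (hg hxy)
  one_mem' := fun _ _ h => h
  inv_mem' := fun {f} hf x y hxy => by
    have hf' : StrictMono f := hf
    rw [← hf'.lt_iff_lt]
    have h : ∀ z, f ((f⁻¹ : ℝ ≃ₜ ℝ) z) = z := fun z => f.apply_symm_apply z
    rw [h, h]
    exact hxy

namespace LineAction

variable {Γ : Type*} [Group Γ]

/-- The map `Φ(g) : ℝ → ℝ` of an action `Φ : Γ → Homeo₊(ℝ)`. -/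
def act (Φ : Γ →* HomeoPlus) (g : Γ) (x : ℝ) : ℝ := (Φ g : ℝ ≃ₜ ℝ) x

/-- The orbit of `x`. -/
def orbit (Φ : Γ →* HomeoPlus) (x : ℝ) : Set ℝ := Set.range fun g => act Φ g x

/-- An action is minimal if every orbit is dense. -/
def IsMinimal (Φ : Γ →* HomeoPlus) : Prop := ∀ x, Dense (orbit Φ x)

/-- `x` is a global fixed point of the action. -/
def IsGlobalFixedPoint (Φ : Γ →* HomeoPlus) (x : ℝ) : Prop := ∀ g, act Φ g x = x

/-- The orbit of `x` is discrete: it meets every compact interval in a finite set, i.e. it is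
a closed discrete subset of the line. -/
def HasDiscreteOrbit (Φ : Γ →* HomeoPlus) (x : ℝ) : Prop :=
  ∀ a b : ℝ, (orbit Φ x ∩ Set.Icc a b).Finite

/-- `ν` is `ρ`-stationary: `ν = ∑ g, ρ(g) g_* ν`. -/
def IsStationary (ρ : PMF Γ) (Φ : Γ →* HomeoPlus) (ν : Measure ℝ) : Prop :=
  ν = Measure.sum fun g => ρ g • Measure.map (act Φ g) ν

/-- An action without global fixed points is `ρ`-harmonic if Lebesgue measure is stationary. -/
structure IsHarmonic (ρ : PMF Γ) (Φ : Γ →* HomeoPlus) : Prop where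
  no_global_fixed_point : ∀ x, ¬ IsGlobalFixedPoint Φ x
  stationary_lebesgue : IsStationary ρ Φ volume

/-- The homeomorphism `φ` conjugates `Φ` to `Ψ`: `φ ∘ Φ(g) = Ψ(g) ∘ φ` for all `g`. -/
def IsConjugacy (φ : ℝ ≃ₜ ℝ) (Φ Ψ : Γ →* HomeoPlus) : Prop :=
  ∀ g x, φ (act Φ g x) = act Ψ g (φ x)

end LineAction

/-! Call a function harmonic if it is fixed by `avg`. Because the walk is symmetric, the primitive
`F` of a stationary measure is a monotone harmonic function, and this harmonic coordinate governs
the whole argument.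

The main tool is `flux`: the signed mass crossing `t` in one step of the walk started from `ν`,
weighted by a function `h` at the landing point. Stationarity gives a discrete Stokes formula
(`flux_sub_flux`), so the flux of a harmonic function does not depend on `t`. For `h = 1` the flux
is the drift `avg F - F`, which is therefore constant; positivity of a related area forces it to
vanish (`avg_primitive`). Then `A = -flux F` is a nonnegative constant. It bounds the displacement
of generators from above (`sq_le_area`) and their quadratic variation from below
(`area_le_quadVar`). Without global fixed points `A > 0`, and `F` is unbounded in both directions.

For uniqueness, a maximum principle (`exists_le_of_sublinear`) confines near-maxima of sublinear
harmonic functions to a compact set. Maximum and minimum sets of a continuous one are closed and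
invariant, and two disjoint such sets would create a discrete orbit, so the function is constant.
The same principle excludes atoms. If `H` is another stationary primitive, comparing fluxes of
squares shows that `H - c F` is sublinear for the right `c`, hence constant.

For existence, monotone solutions of Dirichlet problems on `[-N, N]` are normalized and controlled
by a Harnack inequality; a limit is a nonconstant monotone harmonic function, whose Stieltjes
measure is stationary. A global fixed point carries a stationary Dirac mass. In the minimal case `F`
is a homeomorphism sending `ν` to Lebesgue measure, and uniqueness of the conjugacy is uniqueness of
`ν`. -/

namespace LineAction

variable {Γ : Type*} [Group Γ]

/-! ### Elementary facts about actions on the line. -/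

section Basic

variable (Φ : Γ →* HomeoPlus)

theorem act_mul (g k : Γ) (x : ℝ) : act Φ (g * k) x = act Φ g (act Φ k x) := by
  simp [act]

theorem act_one (x : ℝ) : act Φ 1 x = x := by
  simp [act]

theorem act_inv_act (g : Γ) (x : ℝ) : act Φ g⁻¹ (act Φ g x) = x := by
  rw [← act_mul, inv_mul_cancel, act_one]

theorem act_act_inv (g : Γ) (x : ℝ) : act Φ g (act Φ g⁻¹ x) = x := by
  rw [← act_mul, mul_inv_cancel, act_one]

theorem act_strictMono (g : Γ) : StrictMono (act Φ g) := (Φ g).2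

theorem act_continuous (g : Γ) : Continuous (act Φ g) := (Φ g : ℝ ≃ₜ ℝ).continuous

theorem act_measurable (g : Γ) : Measurable (act Φ g) := (act_continuous Φ g).measurable

theorem le_act_iff (g : Γ) (x t : ℝ) : t ≤ act Φ g x ↔ act Φ g⁻¹ t ≤ x := by
  rw [← (act_strictMono Φ g⁻¹).le_iff_le, act_inv_act]

theorem act_lt_iff (g : Γ) (x t : ℝ) : act Φ g x < t ↔ x < act Φ g⁻¹ t := by
  rw [← (act_strictMono Φ g⁻¹).lt_iff_lt, act_inv_act]

theorem act_tendsto_atTop (g : Γ) : Filter.Tendsto (act Φ g) Filter.atTop Filter.atTop :=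
  Filter.tendsto_atTop.2 fun t => (Filter.eventually_ge_atTop (act Φ g⁻¹ t)).mono
    fun x hx => (le_act_iff Φ g x t).2 hx

theorem act_tendsto_atBot (g : Γ) : Filter.Tendsto (act Φ g) Filter.atBot Filter.atBot :=
  Filter.tendsto_atBot.2 fun t => (Filter.eventually_lt_atBot (act Φ g⁻¹ t)).mono
    fun x hx => ((act_lt_iff Φ g x t).2 hx).le

variable {Φ} in
theorem exists_lt_act (hfix : ∀ x, ¬ IsGlobalFixedPoint Φ x) (x y : ℝ) : ∃ g, y < act Φ g x := by
  by_contra! H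
  have hb : BddAbove (Set.range fun g => act Φ g x) := ⟨y, by rintro _ ⟨g, rfl⟩; exact H g⟩
  -- The supremum of an orbit bounded above would be a global fixed point.
  set s := sSup (Set.range fun g => act Φ g x)
  have hs : ∀ g, act Φ g s ≤ s := by
    intro g
    by_contra! h
    have h1 : act Φ g⁻¹ s < s := by simpa using (act_lt_iff Φ g⁻¹ s s).2 (by simpa using h)
    obtain ⟨_, ⟨k, rfl⟩, hk⟩ := exists_lt_of_lt_csSup (Set.range_nonempty _) h1
    have h2 : s < act Φ (g * k) x := by
      rw [act_mul]
      simpa [act_act_inv] using act_strictMono Φ g hk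
    exact absurd (le_csSup hb ⟨g * k, rfl⟩) (not_le.2 h2)
  refine hfix s fun g => le_antisymm (hs g) ?_
  rw [le_act_iff]
  exact hs g⁻¹

end Basic

/-- A finitely supported symmetric weight whose support `S` generates the group. -/
structure SymmWeight (S : Finset Γ) (w : Γ → ℝ) : Prop where
  pos : ∀ g ∈ S, 0 < w g
  sum_eq_one : ∑ g ∈ S, w g = 1
  inv_mem : ∀ g ∈ S, g⁻¹ ∈ S
  symm : ∀ g, w g⁻¹ = w g
  gen : Subgroup.closure (S : Set Γ) = ⊤

/-- The averaging operator of the random walk. -/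
def avg (Φ : Γ →* HomeoPlus) (S : Finset Γ) (w : Γ → ℝ) (u : ℝ → ℝ) (x : ℝ) : ℝ :=
  ∑ g ∈ S, w g * u (act Φ g x)

/-! ### Symmetric finitely supported random walks. -/

namespace SymmWeight

variable {Φ : Γ →* HomeoPlus} {S : Finset Γ} {w : Γ → ℝ} (hw : SymmWeight S w)

include hw

theorem sum_inv (f : Γ → ℝ) : ∑ g ∈ S, w g * f g⁻¹ = ∑ g ∈ S, w g * f g :=
  Finset.sum_bij' (fun g _ => g⁻¹) (fun g _ => g⁻¹) hw.inv_mem hw.inv_mem (by simp) (by simp)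
    (by simp [hw.symm])

theorem sum_mul_const (c : ℝ) : ∑ g ∈ S, w g * c = c := by
  rw [← Finset.sum_mul, hw.sum_eq_one, one_mul]

theorem nonempty : S.Nonempty := by
  by_contra h
  have := hw.sum_eq_one
  rw [Finset.not_nonempty_iff_eq_empty.1 h] at this
  simp at this

/-- The Harnack constant: each term of a nonnegative family on `S` is at most `C` times its weighted
average. -/
theorem exists_inv_le : ∃ C : ℝ, 0 < C ∧ ∀ g ∈ S, 1 ≤ C * w g := by
  refine ⟨∑ g ∈ S, (w g)⁻¹, Finset.sum_pos (fun g hg => inv_pos.2 (hw.pos g hg)) hw.nonempty,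
    fun g hg => ?_⟩
  have h1 : (w g)⁻¹ ≤ ∑ g ∈ S, (w g)⁻¹ :=
    Finset.single_le_sum (f := fun g => (w g)⁻¹) (fun k hk => (inv_pos.2 (hw.pos k hk)).le) hg
  have h2 := hw.pos g hg
  calc 1 = (w g)⁻¹ * w g := by field_simp
    _ ≤ _ := by gcongr

/-- Stability under the support suffices for full invariance, as the support is closed under
inverses and generates. -/
theorem mem_iff_act_mem {Z : Set ℝ} (hZ : ∀ g ∈ S, ∀ x ∈ Z, act Φ g x ∈ Z) (g : Γ) :
    ∀ x, x ∈ Z ↔ act Φ g x ∈ Z := by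
  have hg : g ∈ Subgroup.closure (S : Set Γ) := by rw [hw.gen]; trivial
  induction hg using Subgroup.closure_induction with
  | mem k hk =>
    exact fun x => ⟨hZ k hk x, fun h => by
      simpa [act_inv_act] using hZ k⁻¹ (hw.inv_mem k hk) _ h⟩
  | one => simp [act_one]
  | mul a b _ _ ha hb => exact fun x => by rw [act_mul, ← ha, ← hb]
  | inv a _ ha => exact fun x => by rw [ha (act Φ a⁻¹ x), act_act_inv]

theorem exists_mem_lt_act (hfix : ∀ x, ¬ IsGlobalFixedPoint Φ x) (x : ℝ) :
    ∃ g ∈ S, x < act Φ g x := by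
  by_contra! H
  refine hfix x fun g => ?_
  refine (hw.mem_iff_act_mem (Φ := Φ) (Z := {x}) (fun k hk y hy => ?_) g x).1 rfl
  rw [Set.mem_singleton_iff] at hy ⊢
  subst hy
  refine le_antisymm (H k hk) ?_
  rw [le_act_iff]
  exact H k⁻¹ (hw.inv_mem k hk)

theorem exists_mem_act_lt (hfix : ∀ x, ¬ IsGlobalFixedPoint Φ x) (x : ℝ) :
    ∃ g ∈ S, act Φ g x < x := by
  obtain ⟨g, hg, h⟩ := hw.exists_mem_lt_act hfix x
  exact ⟨g⁻¹, hw.inv_mem g hg, by simpa [act_lt_iff] using h⟩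

/-- A function attaining its maximum where it is at most its average is constant there. -/
theorem eq_of_le_avg {u : ℝ → ℝ} {x : ℝ} (hmax : ∀ y, u y ≤ u x) (hx : u x ≤ avg Φ S w u x) :
    ∀ g ∈ S, u (act Φ g x) = u x := by
  by_contra! H
  obtain ⟨g, hg, hne⟩ := H
  have : avg Φ S w u x < ∑ g ∈ S, w g * u x :=
    Finset.sum_lt_sum (fun k hk => mul_le_mul_of_nonneg_left (hmax _) (hw.pos k hk).le)
      ⟨g, hg, mul_lt_mul_of_pos_left (lt_of_le_of_ne (hmax _) hne) (hw.pos g hg)⟩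
  rw [hw.sum_mul_const] at this
  linarith

end SymmWeight

end LineAction

namespace LineAction

variable {Γ : Type*} [Group Γ]

/-- Measurable functions that are bounded on bounded sets. -/
def LocBdd (h : ℝ → ℝ) : Prop := Measurable h ∧ ∀ a b, ∃ C, ∀ x ∈ Set.Icc a b, |h x| ≤ C

/-! ### Locally bounded functions. -/

namespace LocBdd

variable {h k : ℝ → ℝ}

theorem integrable (hh : LocBdd h) {a b : ℝ} (h0 : ∀ x, x ∉ Set.Icc a b → h x = 0)
    (ν : Measure ℝ) [IsLocallyFiniteMeasure ν] : Integrable h ν := by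
  obtain ⟨C, hC⟩ := hh.2 a b
  rw [← integrableOn_iff_integrable_of_support_subset (s := Set.Icc a b)
    (fun x hx => by_contra fun hn => hx (h0 x hn))]
  refine Measure.integrableOn_of_bounded (M := C) isCompact_Icc.measure_lt_top.ne
    hh.1.aestronglyMeasurable ?_
  filter_upwards [ae_restrict_mem measurableSet_Icc] with x hx using hC x hx

theorem const (c : ℝ) : LocBdd fun _ => c := ⟨measurable_const, fun _ _ => ⟨|c|, fun _ _ => le_rfl⟩⟩

theorem add (hh : LocBdd h) (hk : LocBdd k) : LocBdd fun x => h x + k x :=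
  ⟨hh.1.add hk.1, fun a b => by
    obtain ⟨C, hC⟩ := hh.2 a b
    obtain ⟨D, hD⟩ := hk.2 a b
    exact ⟨C + D, fun x hx => (abs_add_le _ _).trans (add_le_add (hC x hx) (hD x hx))⟩⟩

theorem mul (hh : LocBdd h) (hk : LocBdd k) : LocBdd fun x => h x * k x :=
  ⟨hh.1.mul hk.1, fun a b => by
    obtain ⟨C, hC⟩ := hh.2 a b
    obtain ⟨D, hD⟩ := hk.2 a b
    refine ⟨C * D, fun x hx => ?_⟩
    rw [abs_mul]
    exact mul_le_mul (hC x hx) (hD x hx) (abs_nonneg _) ((abs_nonneg _).trans (hC x hx))⟩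

theorem const_mul (c : ℝ) (hh : LocBdd h) : LocBdd fun x => c * h x := (const c).mul hh

theorem sub (hh : LocBdd h) (hk : LocBdd k) : LocBdd fun x => h x - k x := by
  simpa [sub_eq_add_neg] using hh.add (hk.const_mul (-1))

theorem sq (hh : LocBdd h) : LocBdd fun x => h x ^ 2 := by
  simpa [pow_two] using hh.mul hh

theorem of_monotone (hh : Monotone h) : LocBdd h :=
  ⟨hh.measurable, fun a b => ⟨max |h a| |h b|, fun _ hx =>
    abs_le_max_abs_abs (hh hx.1) (hh hx.2)⟩⟩

theorem comp_act (hh : LocBdd h) (Φ : Γ →* HomeoPlus) (g : Γ) : LocBdd fun x => h (act Φ g x) :=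
  ⟨hh.1.comp (act_measurable Φ g), fun a b => by
    obtain ⟨C, hC⟩ := hh.2 (act Φ g a) (act Φ g b)
    exact ⟨C, fun x hx => hC _ ⟨(act_strictMono Φ g).monotone hx.1,
      (act_strictMono Φ g).monotone hx.2⟩⟩⟩

theorem indicator (hh : LocBdd h) {s : Set ℝ} (hs : MeasurableSet s) : LocBdd (s.indicator h) :=
  ⟨hh.1.indicator hs, fun a b => by
    obtain ⟨C, hC⟩ := hh.2 a b
    refine ⟨C, fun x hx => ?_⟩
    by_cases h : x ∈ s
    · simpa [h] using hC x hx
    · simpa [h] using (abs_nonneg _).trans (hC x hx)⟩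

theorem sum {ι : Type*} (T : Finset ι) {f : ι → ℝ → ℝ} (hf : ∀ i, LocBdd (f i)) :
    LocBdd fun x => ∑ i ∈ T, f i x := by
  classical
  induction T using Finset.induction_on with
  | empty => simpa using const 0
  | insert i T hi ih => simpa [Finset.sum_insert hi] using (hf i).add ih

theorem avg (hh : LocBdd h) (Φ : Γ →* HomeoPlus) (S : Finset Γ) (w : Γ → ℝ) :
    LocBdd (avg Φ S w h) :=
  sum S fun g => (hh.comp_act Φ g).const_mul (w g)

end LocBdd

/-- A primitive of the measure `ν`. -/
noncomputable def primitive (ν : Measure ℝ) (x : ℝ) : ℝ :=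
  if 0 ≤ x then ν.real (Set.Ico 0 x) else -ν.real (Set.Ico x 0)

/-! ### Primitives of Radon measures. -/

section Primitive

variable (ν : Measure ℝ) [IsLocallyFiniteMeasure ν]

theorem measure_Ico_ne_top (a b : ℝ) : ν (Set.Ico a b) ≠ ∞ :=
  ((measure_mono Set.Ico_subset_Icc_self).trans_lt isCompact_Icc.measure_lt_top).ne

theorem real_Ico_add {a b c : ℝ} (hab : a ≤ b) (hbc : b ≤ c) :
    ν.real (Set.Ico a b) + ν.real (Set.Ico b c) = ν.real (Set.Ico a c) := by
  rw [← Set.Ico_union_Ico_eq_Ico hab hbc, measureReal_union Set.Ico_disjoint_Ico_same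
    measurableSet_Ico (measure_Ico_ne_top ν a b) (measure_Ico_ne_top ν b c)]

theorem primitive_sub {a b : ℝ} (hab : a ≤ b) :
    primitive ν b - primitive ν a = ν.real (Set.Ico a b) := by
  unfold primitive
  split_ifs with hb ha ha
  · rw [← real_Ico_add ν ha hab]; ring
  · rw [← real_Ico_add ν (not_le.1 ha).le hb]; ring
  · linarith
  · rw [← real_Ico_add ν hab (not_le.1 hb).le]; ring

theorem primitive_mono : Monotone (primitive ν) := fun a b hab => by
  have := primitive_sub ν hab
  have h2 : 0 ≤ ν.real (Set.Ico a b) := measureReal_nonneg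
  linarith

end Primitive

/-- The mass of paths crossing `t`, signed: leftward crossings count positively. -/
noncomputable def crossing (Φ : Γ →* HomeoPlus) (g : Γ) (t x : ℝ) : ℝ :=
  (Set.Ici t).indicator 1 x - (Set.Ici t).indicator 1 (act Φ g x)

/-- The flux through `t`, for the random walk started from `ν`, of mass weighted by the value
of `h` at the landing point. -/
noncomputable def flux (Φ : Γ →* HomeoPlus) (S : Finset Γ) (w : Γ → ℝ) (ν : Measure ℝ)
    (h : ℝ → ℝ) (t : ℝ) : ℝ :=
  ∑ g ∈ S, w g * ∫ x, crossing Φ g t x * h (act Φ g x) ∂ν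

/-- Finite-sum form of stationarity. -/
def StationarySum (Φ : Γ →* HomeoPlus) (S : Finset Γ) (w : Γ → ℝ) (ν : Measure ℝ) : Prop :=
  ν = ∑ g ∈ S, ENNReal.ofReal (w g) • Measure.map (act Φ g) ν

/-! ### Flux and the discrete Stokes formula. -/

section Flux

variable {Φ : Γ →* HomeoPlus} {S : Finset Γ} {w : Γ → ℝ} {ν : Measure ℝ}

theorem crossing_eq (g : Γ) (t x : ℝ) :
    crossing Φ g t x = (Set.Ico t (act Φ g⁻¹ t)).indicator 1 x -
      (Set.Ico (act Φ g⁻¹ t) t).indicator 1 x := by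
  have := le_act_iff Φ g x t
  simp only [crossing, Set.indicator_apply, Set.mem_Ici, Set.mem_Ico, this, Pi.one_apply]
  by_cases h1 : t ≤ x <;> by_cases h2 : act Φ g⁻¹ t ≤ x <;> simp [h1, h2, not_lt.2, not_le.1]

theorem crossing_eq_zero (g : Γ) {t x : ℝ}
    (hx : x ∉ Set.Icc (min t (act Φ g⁻¹ t)) (max t (act Φ g⁻¹ t))) : crossing Φ g t x = 0 := by
  rw [crossing_eq, Set.indicator_of_notMem, Set.indicator_of_notMem, sub_zero]
  · exact fun h => hx ⟨(min_le_right _ _).trans h.1, h.2.le.trans (le_max_left _ _)⟩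
  · exact fun h => hx ⟨(min_le_left _ _).trans h.1, h.2.le.trans (le_max_right _ _)⟩

theorem locBdd_crossing (g : Γ) (t : ℝ) : LocBdd (crossing Φ g t) :=
  ((LocBdd.const 1).indicator measurableSet_Ici).sub
    (((LocBdd.const 1).indicator measurableSet_Ici).comp_act Φ g)

variable [IsLocallyFiniteMeasure ν]

theorem integrable_crossing_mul (g : Γ) (t : ℝ) {h : ℝ → ℝ} (hh : LocBdd h) :
    Integrable (fun x => crossing Φ g t x * h x) ν :=
  ((locBdd_crossing g t).mul hh).integrable
    (fun x hx => by rw [crossing_eq_zero g hx, zero_mul]) ν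

theorem integral_crossing (g : Γ) (t : ℝ) :
    ∫ x, crossing Φ g t x ∂ν = primitive ν (act Φ g⁻¹ t) - primitive ν t := by
  simp only [crossing_eq]
  rcases le_total t (act Φ g⁻¹ t) with h | h
  · rw [Set.Ico_eq_empty (not_lt.2 h)]
    simp [integral_indicator, measurableSet_Ico, primitive_sub ν h]
  · rw [Set.Ico_eq_empty (not_lt.2 h)]
    simp [integral_neg, integral_indicator, measurableSet_Ico, ← primitive_sub ν h]

theorem integral_abs_crossing (g : Γ) (t : ℝ) :
    ∫ x, |crossing Φ g t x| ∂ν = |primitive ν (act Φ g⁻¹ t) - primitive ν t| := by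
  have key : ∀ s : Set ℝ, ∀ x, |s.indicator (1 : ℝ → ℝ) x| = s.indicator 1 x := fun s x =>
    abs_of_nonneg (Set.indicator_nonneg (fun _ _ => zero_le_one) x)
  simp only [crossing_eq]
  rcases le_total t (act Φ g⁻¹ t) with h | h
  · rw [Set.Ico_eq_empty (not_lt.2 h), abs_of_nonneg (sub_nonneg.2 (primitive_mono ν h))]
    simp [key, integral_indicator, measurableSet_Ico, primitive_sub ν h]
  · rw [Set.Ico_eq_empty (not_lt.2 h), abs_of_nonpos (sub_nonpos.2 (primitive_mono ν h))]
    simp [key, integral_indicator, measurableSet_Ico, ← primitive_sub ν h]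

theorem flux_linear {h k : ℝ → ℝ} (hh : LocBdd h) (hk : LocBdd k) (a b t : ℝ) :
    flux Φ S w ν (fun x => a * h x + b * k x) t =
      a * flux Φ S w ν h t + b * flux Φ S w ν k t := by
  simp only [flux, Finset.mul_sum]
  rw [← Finset.sum_add_distrib]
  refine Finset.sum_congr rfl fun g _ => ?_
  have h1 := integrable_crossing_mul (ν := ν) (Φ := Φ) g t (hh.comp_act Φ g)
  have h2 := integrable_crossing_mul (ν := ν) (Φ := Φ) g t (hk.comp_act Φ g)
  have : ∀ x, crossing Φ g t x * (a * h (act Φ g x) + b * k (act Φ g x)) =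
      a * (crossing Φ g t x * h (act Φ g x)) + b * (crossing Φ g t x * k (act Φ g x)) :=
    fun x => by ring
  simp only [this]
  rw [integral_add (h1.const_mul a) (h2.const_mul b), integral_const_mul, integral_const_mul]
  ring

/-- The net mass that `g` carries across `t` is the increment of the primitive from `t` to `g⁻¹ t`;
symmetry of the weight replaces `g⁻¹` by `g`. -/
theorem flux_one (hw : SymmWeight S w) (t : ℝ) :
    flux Φ S w ν (fun _ => 1) t = avg Φ S w (primitive ν) t - primitive ν t := by
  simp only [flux, mul_one, integral_crossing, mul_sub, Finset.sum_sub_distrib]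
  rw [hw.sum_inv fun g => primitive ν (act Φ g t), hw.sum_mul_const]
  rfl

theorem StationarySum.integral_eq (hst : StationarySum Φ S w ν) (hw : SymmWeight S w)
    {h : ℝ → ℝ} (hh : LocBdd h) {a b : ℝ} (h0 : ∀ x, x ∉ Set.Icc a b → h x = 0) :
    ∫ x, h x ∂ν = ∑ g ∈ S, w g * ∫ x, h (act Φ g x) ∂ν := by
  have key : ∀ g : Γ, Integrable (fun x => h (act Φ g x)) ν := fun g =>
    (hh.comp_act Φ g).integrable (a := act Φ g⁻¹ a) (b := act Φ g⁻¹ b) (fun x hx => h0 _ fun hm =>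
      hx ⟨(le_act_iff Φ g x a).1 hm.1, by
        simpa [act_inv_act] using (act_strictMono Φ g⁻¹).monotone hm.2⟩) ν
  conv_lhs => rw [hst]
  rw [integral_finsetSum_measure]
  · refine Finset.sum_congr rfl fun g hg => ?_
    rw [integral_smul_measure, integral_map (act_measurable Φ g).aemeasurable
      hh.1.aestronglyMeasurable, ENNReal.toReal_ofReal (hw.pos g hg).le, smul_eq_mul]
  · intro g hg
    refine Integrable.smul_measure ?_ ENNReal.ofReal_ne_top
    exact (integrable_map_measure hh.1.aestronglyMeasurable
      (act_measurable Φ g).aemeasurable).2 (key g)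

/-- The crossings at `a` minus those at `b` amount to the indicator of `[a, b)` at `x` minus the
same at `g x`. The first term yields the integral of `avg h`; by stationarity the second yields that
of `h`. -/
theorem StationarySum.flux_sub_flux (hst : StationarySum Φ S w ν) (hw : SymmWeight S w)
    {h : ℝ → ℝ} (hh : LocBdd h) {a b : ℝ} (hab : a ≤ b) :
    flux Φ S w ν h a - flux Φ S w ν h b = ∫ x in Set.Ico a b, (avg Φ S w h x - h x) ∂ν := by
  have hI : ∀ {f : ℝ → ℝ}, LocBdd f → Integrable ((Set.Ico a b).indicator f) ν := fun hf =>
    (hf.indicator measurableSet_Ico).integrable (a := a) (b := b)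
      (fun x hx => Set.indicator_of_notMem (fun h => hx (Set.Ico_subset_Icc_self h)) _) ν
  have hind : ∀ g x, crossing Φ g a x - crossing Φ g b x =
      (Set.Ico a b).indicator 1 x - (Set.Ico a b).indicator 1 (act Φ g x) := by
    have key : ∀ y, (Set.Ici a).indicator (1 : ℝ → ℝ) y - (Set.Ici b).indicator 1 y =
        (Set.Ico a b).indicator 1 y := by
      intro y
      simp only [Set.indicator_apply, Set.mem_Ici, Set.mem_Ico, Pi.one_apply]
      by_cases h1 : a ≤ y <;> by_cases h2 : b ≤ y <;> simp [h1, h2, not_lt.2, not_le.1]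
      · exact absurd (hab.trans h2) h1
    intro g x
    simp only [crossing]
    rw [← key, ← key]
    ring
  have e1 : ∀ g, (∫ x, crossing Φ g a x * h (act Φ g x) ∂ν) -
      ∫ x, crossing Φ g b x * h (act Φ g x) ∂ν =
      (∫ x, (Set.Ico a b).indicator (fun x => h (act Φ g x)) x ∂ν) -
        ∫ x, (Set.Ico a b).indicator h (act Φ g x) ∂ν := by
    intro g
    have i1 := integrable_crossing_mul (ν := ν) (Φ := Φ) g a (hh.comp_act Φ g)
    have i2 := integrable_crossing_mul (ν := ν) (Φ := Φ) g b (hh.comp_act Φ g)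
    have i3 := hI (hh.comp_act Φ g)
    have e : ∀ x, crossing Φ g a x * h (act Φ g x) - crossing Φ g b x * h (act Φ g x) =
        (Set.Ico a b).indicator (fun x => h (act Φ g x)) x -
          (Set.Ico a b).indicator h (act Φ g x) := by
      intro x
      rw [← sub_mul, hind, sub_mul]
      simp only [Set.indicator_apply, Pi.one_apply, ite_mul, one_mul, zero_mul]
    have i4 : Integrable (fun x => (Set.Ico a b).indicator h (act Φ g x)) ν := by
      refine (i3.sub (i1.sub i2)).congr (Filter.Eventually.of_forall fun x => ?_)
      simp only [Pi.sub_apply, e]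
      ring
    rw [← integral_sub i1 i2, ← integral_sub i3 i4]
    exact integral_congr_ae (Filter.Eventually.of_forall e)
  have e2 := hst.integral_eq hw (hh.indicator (measurableSet_Ico (a := a) (b := b)))
    (a := a) (b := b)
    (fun x hx => Set.indicator_of_notMem (fun h => hx (Set.Ico_subset_Icc_self h)) _)
  have e3 : ∫ x, (Set.Ico a b).indicator (avg Φ S w h) x ∂ν =
      ∑ g ∈ S, w g * ∫ x, (Set.Ico a b).indicator (fun x => h (act Φ g x)) x ∂ν := by
    simp only [← integral_const_mul]
    rw [← integral_finsetSum _ fun g _ => (hI (hh.comp_act Φ g)).const_mul (w g)]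
    congr 1
    ext x
    by_cases hx : x ∈ Set.Ico a b <;> simp [hx, avg]
  calc flux Φ S w ν h a - flux Φ S w ν h b
      = ∑ g ∈ S, w g * ((∫ x, crossing Φ g a x * h (act Φ g x) ∂ν) -
          ∫ x, crossing Φ g b x * h (act Φ g x) ∂ν) := by
        simp only [flux, mul_sub, Finset.sum_sub_distrib]
    _ = (∫ x, (Set.Ico a b).indicator (avg Φ S w h) x ∂ν) -
          ∫ x, (Set.Ico a b).indicator h x ∂ν := by
        simp only [e1, mul_sub, Finset.sum_sub_distrib]
        rw [e3, e2]
    _ = ∫ x in Set.Ico a b, (avg Φ S w h x - h x) ∂ν := by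
        rw [← integral_sub (hI (hh.avg Φ S w)) (hI hh), ← integral_indicator measurableSet_Ico]
        congr 1
        ext x
        by_cases hx : x ∈ Set.Ico a b <;> simp [hx]

end Flux

end LineAction

namespace LineAction

variable {Γ : Type*} [Group Γ]

/-! ### Harmonic functions and one-step estimates. -/

section Harmonic

variable {Φ : Γ →* HomeoPlus} {S : Finset Γ} {w : Γ → ℝ}

theorem tendsto_avg {l : Filter ℝ} (hl : ∀ g, Filter.Tendsto (act Φ g) l l)
    (hw : SymmWeight S w) {F : ℝ → ℝ} {L : ℝ} (hF : Filter.Tendsto F l (nhds L)) :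
    Filter.Tendsto (avg Φ S w F) l (nhds L) := by
  have := tendsto_finsetSum S fun g _ => (hF.comp (hl g)).const_mul (w g)
  rwa [hw.sum_mul_const] at this

/-- The quadratic variation of one step. -/
def quadVar (Φ : Γ →* HomeoPlus) (S : Finset Γ) (w : Γ → ℝ) (F : ℝ → ℝ) (x : ℝ) : ℝ :=
  ∑ g ∈ S, w g * (F (act Φ g x) - F x) ^ 2

theorem avg_sq (hw : SymmWeight S w) {F : ℝ → ℝ} (hF : ∀ x, avg Φ S w F x = F x) (x : ℝ) :
    avg Φ S w (fun y => F y ^ 2) x = F x ^ 2 + quadVar Φ S w F x := by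
  have h1 : quadVar Φ S w F x = avg Φ S w (fun y => F y ^ 2) x
      - 2 * F x * avg Φ S w F x + ∑ g ∈ S, w g * F x ^ 2 := by
    simp only [quadVar, avg, Finset.mul_sum]
    rw [← Finset.sum_sub_distrib, ← Finset.sum_add_distrib]
    exact Finset.sum_congr rfl fun g _ => by ring
  rw [h1, hF, hw.sum_mul_const]
  ring

theorem quadVar_nonneg (hw : SymmWeight S w) (F : ℝ → ℝ) (x : ℝ) : 0 ≤ quadVar Φ S w F x :=
  Finset.sum_nonneg fun g hg => mul_nonneg (hw.pos g hg).le (sq_nonneg _)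

theorem tendsto_quadVar {l : Filter ℝ} (hl : ∀ g, Filter.Tendsto (act Φ g) l l)
    {F : ℝ → ℝ} {L : ℝ} (hF : Filter.Tendsto F l (nhds L)) :
    Filter.Tendsto (quadVar Φ S w F) l (nhds 0) := by
  have := tendsto_finsetSum S fun g _ => (((hF.comp (hl g)).sub hF).pow 2).const_mul (w g)
  simp only [sub_self, ne_eq, OfNat.ofNat_ne_zero, not_false_eq_true, zero_pow, mul_zero,
    Finset.sum_const_zero] at this
  exact this

theorem avg_linear (f k : ℝ → ℝ) (a b x : ℝ) :
    avg Φ S w (fun y => a * f y + b * k y) x = a * avg Φ S w f x + b * avg Φ S w k x := by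
  simp only [avg, Finset.mul_sum]
  rw [← Finset.sum_add_distrib]
  exact Finset.sum_congr rfl fun g _ => by ring

/-- One nonnegative term of the averaging identity for `F b - F a`. -/
theorem weight_mul_sub_le (hw : SymmWeight S w) {F : ℝ → ℝ} (hmono : Monotone F)
    (hF : ∀ x, avg Φ S w F x = F x) {g : Γ} (hg : g ∈ S) {a b : ℝ} (hab : a ≤ b) :
    w g * (F (act Φ g b) - F (act Φ g a)) ≤ F b - F a := by
  calc w g * (F (act Φ g b) - F (act Φ g a))
      ≤ ∑ k ∈ S, w k * (F (act Φ k b) - F (act Φ k a)) :=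
        Finset.single_le_sum (f := fun k => w k * (F (act Φ k b) - F (act Φ k a)))
          (fun k hk => mul_nonneg (hw.pos k hk).le
            (sub_nonneg.2 (hmono ((act_strictMono Φ k).monotone hab)))) hg
    _ = F b - F a := by
        rw [← hF a, ← hF b]
        simp only [avg, mul_sub, Finset.sum_sub_distrib]

/-- A jump of `g` across `t` lands between `t` and `g t`. -/
theorem abs_sub_le_of_crossing {F : ℝ → ℝ} (hF : Monotone F) (g : Γ) {t x : ℝ}
    (h : crossing Φ g t x ≠ 0) : |F (act Φ g x) - F t| ≤ |F (act Φ g t) - F t| := by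
  have hm := (act_strictMono Φ g).monotone
  by_cases h1 : t ≤ x
  · by_cases h2 : t ≤ act Φ g x
    · simp [crossing, h1, h2] at h
    · have h3 := hF (not_le.1 h2).le
      have h4 := hF (hm h1)
      rw [abs_of_nonpos (by linarith), abs_of_nonpos (by linarith)]
      linarith
  · by_cases h2 : t ≤ act Φ g x
    · have h3 := hF h2
      have h4 := hF (hm (not_le.1 h1).le)
      rw [abs_of_nonneg (by linarith), abs_of_nonneg (by linarith)]
      linarith
    · simp [crossing, h1, h2] at h

theorem crossing_mul_nonneg {F : ℝ → ℝ} (hF : Monotone F) (g : Γ) (t x : ℝ) :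
    0 ≤ crossing Φ g t x * (F t - F (act Φ g x)) := by
  by_cases h1 : t ≤ x <;> by_cases h2 : t ≤ act Φ g x <;> simp [crossing, h1, h2]
  · exact hF (not_le.1 h2).le
  · exact hF h2

end Harmonic

/-- The right side is the `ν × ν` mass of the half square `x ≤ y`. By Tonelli the two half squares
have equal mass, and together they cover the square; they overlap on the diagonal, so atoms only
help. -/
theorem half_sq_le_integral (ν : Measure ℝ) [IsLocallyFiniteMeasure ν] {t s : ℝ} (hts : t ≤ s) :
    (primitive ν s - primitive ν t) ^ 2 / 2 ≤
      ∫ x in Set.Ico t s, (primitive ν s - primitive ν x) ∂ν := by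
  have : IsFiniteMeasure (ν.restrict (Set.Ico t s)) :=
    ⟨by simpa using (measure_Ico_ne_top ν t s).lt_top⟩
  set μ := ν.restrict (Set.Ico t s) with hμ
  have e1 : ∫ x in Set.Ico t s, (primitive ν s - primitive ν x) ∂ν =
      ∫ x, (μ (Set.Ici x)).toReal ∂μ := by
    refine setIntegral_congr_fun measurableSet_Ico fun x hx => ?_
    rw [primitive_sub ν hx.2.le, hμ, Measure.restrict_apply measurableSet_Ici]
    congr 2
    ext y
    simp only [Set.mem_inter_iff, Set.mem_Ici, Set.mem_Ico]
    exact ⟨fun h => ⟨h.1, hx.1.trans h.1, h.2⟩, fun h => ⟨h.1, h.2.2⟩⟩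
  have hE : MeasurableSet {p : ℝ × ℝ | p.1 ≤ p.2} := measurableSet_le measurable_fst measurable_snd
  have e2 : ∫⁻ x, μ (Set.Ici x) ∂μ = ∫⁻ x, μ (Set.Iic x) ∂μ :=
    (Measure.prod_apply (μ := μ) (ν := μ) hE).symm.trans (Measure.prod_apply_symm hE)
  have hmeas : Measurable fun x => μ (Set.Ici x) :=
    (antitone_iff_forall_lt.2 fun a b h => measure_mono (Set.Ici_subset_Ici.2 h.le)).measurable
  have e3 : μ Set.univ * μ Set.univ ≤ 2 * ∫⁻ x, μ (Set.Ici x) ∂μ := by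
    rw [two_mul]
    nth_rewrite 2 [e2]
    rw [← lintegral_add_left hmeas, ← lintegral_const]
    refine lintegral_mono fun x => ?_
    rw [← Set.Iic_union_Ici (a := x), add_comm]
    exact measure_union_le _ _
  have e4 : ∫ x, (μ (Set.Ici x)).toReal ∂μ = (∫⁻ x, μ (Set.Ici x) ∂μ).toReal :=
    integral_toReal hmeas.aemeasurable
      (Filter.Eventually.of_forall fun x => measure_lt_top _ _)
  have hfin : ∫⁻ x, μ (Set.Ici x) ∂μ ≠ ∞ := by
    refine ne_top_of_le_ne_top (b := μ Set.univ * μ Set.univ) ?_ ?_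
    · exact ENNReal.mul_ne_top (measure_ne_top _ _) (measure_ne_top _ _)
    · rw [← lintegral_const]
      exact lintegral_mono fun x => measure_mono (Set.subset_univ _)
  have e5 := ENNReal.toReal_mono (ENNReal.mul_ne_top ENNReal.ofNat_ne_top hfin) e3
  rw [ENNReal.toReal_mul, ENNReal.toReal_mul, ← e4, ← e1] at e5
  have e6 : (μ Set.univ).toReal = primitive ν s - primitive ν t := by
    rw [primitive_sub ν hts, hμ, Measure.restrict_apply_univ]
    rfl
  rw [e6, ENNReal.toReal_ofNat] at e5
  linarith

/-! ### The harmonic coordinate of a stationary measure. -/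

section Stationary

variable {Φ : Γ →* HomeoPlus} {S : Finset Γ} {w : Γ → ℝ} {ν : Measure ℝ}
  [IsLocallyFiniteMeasure ν]

theorem locBdd_primitive : LocBdd (primitive ν) := LocBdd.of_monotone (primitive_mono ν)

omit [IsLocallyFiniteMeasure ν] in
theorem flux_sub_const_eq (h : ℝ → ℝ) (c t : ℝ) :
    flux Φ S w ν (fun x => h x - c) t =
      -∑ g ∈ S, w g * ∫ x, crossing Φ g t x * (c - h (act Φ g x)) ∂ν := by
  rw [flux, ← Finset.sum_neg_distrib]
  refine Finset.sum_congr rfl fun g _ => ?_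
  rw [← mul_neg, ← integral_neg]
  congr 2
  ext x
  ring

theorem flux_sub_const {h : ℝ → ℝ} (hh : LocBdd h) (c t : ℝ) :
    flux Φ S w ν (fun x => h x - c) t =
      flux Φ S w ν h t - c * flux Φ S w ν (fun _ => 1) t := by
  have := flux_linear (Φ := Φ) (S := S) (w := w) (ν := ν) hh (LocBdd.const 1) 1 (-c) t
  simp only [one_mul, mul_one] at this
  simpa [sub_eq_add_neg] using this

theorem abs_flux_le (hw : SymmWeight S w) {k : ℝ → ℝ} (hk : LocBdd k) {t : ℝ} {b : Γ → ℝ}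
    (hb : ∀ g ∈ S, ∀ x, crossing Φ g t x ≠ 0 → |k (act Φ g x)| ≤ b g) :
    |flux Φ S w ν k t| ≤
      ∑ g ∈ S, w g * (b g * |primitive ν (act Φ g⁻¹ t) - primitive ν t|) := by
  refine (Finset.abs_sum_le_sum_abs _ _).trans (Finset.sum_le_sum fun g hg => ?_)
  rw [abs_mul, abs_of_pos (hw.pos g hg)]
  refine mul_le_mul_of_nonneg_left ?_ (hw.pos g hg).le
  rw [← integral_abs_crossing, ← integral_const_mul]
  refine abs_integral_le_integral_abs.trans (integral_mono ?_ ?_ fun x => ?_)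
  · exact (integrable_crossing_mul g t (hk.comp_act Φ g)).abs
  · have := (integrable_crossing_mul (ν := ν) (Φ := Φ) g t (LocBdd.const 1)).abs.const_mul (b g)
    simpa using this
  · simp only [abs_mul]
    by_cases h : crossing Φ g t x = 0
    · simp [h]
    · rw [mul_comm]
      exact mul_le_mul_of_nonneg_right (hb g hg x h) (abs_nonneg _)

namespace StationarySum

variable (hst : StationarySum Φ S w ν) (hw : SymmWeight S w)

include hst hw

theorem flux_eq {h : ℝ → ℝ} (hh : LocBdd h) (hP : ∀ x, avg Φ S w h x = h x) (a b : ℝ) :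
    flux Φ S w ν h a = flux Φ S w ν h b := by
  wlog hab : a ≤ b generalizing a b
  · exact (this b a (le_of_not_ge hab)).symm
  have := hst.flux_sub_flux hw hh hab
  simp only [hP, sub_self, integral_zero] at this
  linarith

/-- Symmetry of the walk forces the drift of the primitive to vanish. -/
theorem avg_primitive (x : ℝ) : avg Φ S w (primitive ν) x = primitive ν x := by
  set F := primitive ν with hFdef
  set c := flux Φ S w ν (fun _ => 1) 0
  have h1 : ∀ t, flux Φ S w ν (fun _ => 1) t = c := fun t =>
    hst.flux_eq hw (LocBdd.const 1) (fun x => hw.sum_mul_const 1) t 0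
  have hc : ∀ t, avg Φ S w F t - F t = c := fun t => by rw [← flux_one hw, h1]
  set A : ℝ → ℝ := fun t => -flux Φ S w ν (fun x => F x - F t) t with hA
  have hA0 : ∀ t, 0 ≤ A t := fun t => by
    simp only [hA, flux_sub_const_eq, neg_neg]
    exact Finset.sum_nonneg fun g hg => mul_nonneg (hw.pos g hg).le
      (integral_nonneg fun x => crossing_mul_nonneg (primitive_mono ν) g t x)
  -- The Stokes formula for `F` contributes `c` once; recentring at `F t` contributes it again.
  have hAF : ∀ a b, a ≤ b → A b - A a = 2 * c * (F b - F a) := fun a b hab => by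
    have h2 := hst.flux_sub_flux hw (locBdd_primitive (ν := ν)) hab
    simp only [← hFdef, hc, integral_const, measureReal_restrict_apply_univ, smul_eq_mul] at h2
    rw [← primitive_sub ν hab] at h2
    simp only [hA]
    rw [flux_sub_const locBdd_primitive, flux_sub_const locBdd_primitive, h1, h1]
    linarith
  have hmono : Monotone F := primitive_mono ν
  suffices c = 0 by have := hc x; linarith
  by_contra hne
  -- Since `A ≥ 0`, a nonzero `c` bounds `F` on one side. There `F` and `avg F` have the same limit,
  -- so the constant drift is zero.
  rcases lt_or_gt_of_ne hne with hneg | hpos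
  · have hb : BddAbove (Set.range F) := by
      refine ⟨F 0 + A 0 / (2 * -c), ?_⟩
      rintro _ ⟨y, rfl⟩
      have h3 : F (max y 0) - F 0 ≤ A 0 / (2 * -c) := by
        rw [le_div_iff₀ (by linarith)]
        have := hAF 0 (max y 0) (le_max_right _ _)
        have := hA0 (max y 0)
        linarith
      have := hmono (le_max_left y 0)
      linarith
    have h4 := tendsto_atTop_ciSup hmono hb
    have h5 := (tendsto_avg (act_tendsto_atTop Φ) hw h4).sub h4
    simp only [hc, sub_self] at h5
    exact hne (tendsto_nhds_unique tendsto_const_nhds h5)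
  · have hb : BddBelow (Set.range F) := by
      refine ⟨F 0 - A 0 / (2 * c), ?_⟩
      rintro _ ⟨y, rfl⟩
      have h3 : F 0 - F (min y 0) ≤ A 0 / (2 * c) := by
        rw [le_div_iff₀ (by linarith)]
        have := hAF (min y 0) 0 (min_le_right _ _)
        have := hA0 (min y 0)
        linarith
      have := hmono (min_le_left y 0)
      linarith
    have h4 := tendsto_atBot_ciInf hmono hb
    have h5 := (tendsto_avg (act_tendsto_atBot Φ) hw h4).sub h4
    simp only [hc, sub_self] at h5
    exact hne (tendsto_nhds_unique tendsto_const_nhds h5)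

theorem flux_one_eq (t : ℝ) : flux Φ S w ν (fun _ => 1) t = 0 := by
  rw [flux_one hw, hst.avg_primitive hw, sub_self]

/-- The area between the graphs of the group elements and the diagonal lines through `(t, t)`
does not depend on `t`. -/
theorem area_eq (t : ℝ) : ∑ g ∈ S, w g * ∫ x, crossing Φ g t x *
    (primitive ν t - primitive ν (act Φ g x)) ∂ν = -flux Φ S w ν (primitive ν) 0 := by
  rw [hst.flux_eq hw (locBdd_primitive (ν := ν)) (hst.avg_primitive hw) 0 t]
  have := flux_sub_const (Φ := Φ) (S := S) (w := w) (ν := ν)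
    (locBdd_primitive (ν := ν)) (primitive ν t) t
  rw [flux_sub_const_eq, hst.flux_one_eq hw, mul_zero, sub_zero] at this
  linarith

/-- The mass crossing `t` under `g` is the displacement of `t` under `g⁻¹`, and the height of a
crossing is at most the displacement under `g`. The product is split by the arithmetic-geometric
mean inequality, and symmetry merges the two halves. -/
theorem area_le_quadVar (t : ℝ) :
    -flux Φ S w ν (primitive ν) 0 ≤ quadVar Φ S w (primitive ν) t := by
  set F := primitive ν with hF
  have h1 : flux Φ S w ν F 0 = flux Φ S w ν (fun x => F x - F t) t := by
    rw [flux_sub_const locBdd_primitive, hst.flux_one_eq hw,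
      hst.flux_eq hw locBdd_primitive (hst.avg_primitive hw) 0 t]
    ring
  have h2 := abs_flux_le (ν := ν) (t := t) hw (locBdd_primitive.sub (LocBdd.const (F t)))
    (b := fun g => |F (act Φ g t) - F t|)
    (fun g _ x hx => abs_sub_le_of_crossing (primitive_mono ν) g hx)
  rw [h1]
  refine (neg_le_abs _).trans (h2.trans ?_)
  have h3 : ∑ g ∈ S, w g * (|F (act Φ g t) - F t| * |F (act Φ g⁻¹ t) - F t|) ≤
      ∑ g ∈ S, (w g * (F (act Φ g t) - F t) ^ 2 / 2 + w g * (F (act Φ g⁻¹ t) - F t) ^ 2 / 2) := by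
    refine Finset.sum_le_sum fun g hg => ?_
    rw [← sq_abs (F (act Φ g t) - F t), ← sq_abs (F (act Φ g⁻¹ t) - F t)]
    nlinarith [mul_nonneg (hw.pos g hg).le
      (sq_nonneg (|F (act Φ g t) - F t| - |F (act Φ g⁻¹ t) - F t|))]
  refine h3.trans (le_of_eq ?_)
  rw [Finset.sum_add_distrib, ← Finset.sum_div, ← Finset.sum_div,
    hw.sum_inv fun g => (F (act Φ g t) - F t) ^ 2, quadVar]
  ring

/-- With `s = g⁻¹ t`, every `x` in `[t, s)` jumps below `t`, by a height of at least `w g * (F s - F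
x)`: `weight_mul_sub_le` for `g⁻¹` on `[g x, t]`. Integration brings in `half_sq_le_integral`. -/
theorem sq_le_area {g : Γ} (hg : g ∈ S) {t : ℝ} (ht : t ≤ act Φ g⁻¹ t) :
    w g ^ 2 / 2 * (primitive ν (act Φ g⁻¹ t) - primitive ν t) ^ 2 ≤
      -flux Φ S w ν (primitive ν) 0 := by
  set F := primitive ν with hF
  have hmono : Monotone F := primitive_mono ν
  set s := act Φ g⁻¹ t with hs
  rw [← hst.area_eq hw t]
  have h1 : w g * (∫ x in Set.Ico t s, (F s - F x) ∂ν) ≤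
      ∫ x, crossing Φ g t x * (F t - F (act Φ g x)) ∂ν := by
    rw [← integral_indicator measurableSet_Ico, ← integral_const_mul]
    refine integral_mono (Integrable.const_mul (LocBdd.integrable (a := t) (b := s) ?_ ?_ ν) _)
      (integrable_crossing_mul g t (((LocBdd.const (F t)).sub locBdd_primitive).comp_act Φ g))
      fun x => ?_
    · exact ((LocBdd.const (F s)).sub locBdd_primitive).indicator measurableSet_Ico
    · exact fun x hx => Set.indicator_of_notMem (fun h => hx (Set.Ico_subset_Icc_self h)) _
    · simp only
      by_cases hx : x ∈ Set.Ico t s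
      · rw [Set.indicator_of_mem hx, crossing_eq, Set.indicator_of_mem hx,
          Set.Ico_eq_empty (not_lt.2 ht)]
        have h2 := weight_mul_sub_le hw hmono (hst.avg_primitive hw) (hw.inv_mem g hg)
          (show act Φ g x ≤ act Φ g s from (act_strictMono Φ g).monotone hx.2.le)
        rw [act_inv_act, act_inv_act, hw.symm] at h2
        rw [hs, act_act_inv, ← hs] at h2
        simpa using h2
      · rw [Set.indicator_of_notMem hx, mul_zero]
        exact crossing_mul_nonneg hmono g t x
  have h2 := half_sq_le_integral ν ht
  have hwg := hw.pos g hg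
  calc w g ^ 2 / 2 * (F s - F t) ^ 2 = w g * (w g * ((F s - F t) ^ 2 / 2)) := by ring
    _ ≤ w g * (w g * ∫ x in Set.Ico t s, (F s - F x) ∂ν) := by gcongr
    _ ≤ w g * ∫ x, crossing Φ g t x * (F t - F (act Φ g x)) ∂ν := by gcongr
    _ ≤ _ := Finset.single_le_sum
        (f := fun g => w g * ∫ x, crossing Φ g t x * (F t - F (act Φ g x)) ∂ν)
        (fun k hk => mul_nonneg (hw.pos k hk).le
          (integral_nonneg fun x => crossing_mul_nonneg hmono k t x)) hg

theorem area_nonneg : 0 ≤ -flux Φ S w ν (primitive ν) 0 := by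
  rw [← hst.area_eq hw 0]
  exact Finset.sum_nonneg fun g hg => mul_nonneg (hw.pos g hg).le
    (integral_nonneg fun x => crossing_mul_nonneg (primitive_mono ν) g 0 x)

/-- In the coordinate given by a stationary measure, generators have bounded displacement. -/
theorem exists_displacement_bound :
    ∃ B, 0 < B ∧ ∀ g ∈ S, ∀ x, |primitive ν (act Φ g x) - primitive ν x| ≤ B := by
  set F := primitive ν with hF
  have hmono : Monotone F := primitive_mono ν
  obtain ⟨C, hC0, hC⟩ := hw.exists_inv_le
  set A := -flux Φ S w ν F 0 with hA
  have hA0 : 0 ≤ A := hst.area_nonneg hw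
  set B := 2 * C ^ 2 * A + 1 with hB
  have hB0 : 0 < B := by positivity
  have hup : ∀ g ∈ S, ∀ x, x ≤ act Φ g x → F (act Φ g x) - F x ≤ B := by
    intro g hg x hx
    have h1 := hst.sq_le_area hw (hw.inv_mem g hg) (t := x) (by rwa [inv_inv])
    rw [inv_inv, hw.symm, ← hF, ← hA] at h1
    set d := F (act Φ g x) - F x
    have h2 : d ^ 2 ≤ 2 * C ^ 2 * A := by
      have h3 : 1 ≤ (C * w g) ^ 2 := one_le_pow₀ (hC g hg)
      nlinarith [mul_le_mul_of_nonneg_left h1 (sq_nonneg C), mul_nonneg (sub_nonneg.2 h3)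
        (sq_nonneg d)]
    nlinarith [sq_nonneg (d - 1 / 2)]
  -- A downward move by `g` is the image under `g` of the upward move from `x` to `g⁻¹ x`, which
  -- costs a factor `C`.
  refine ⟨B + C * B, by positivity, fun g hg x => ?_⟩
  rcases le_total x (act Φ g x) with h | h
  · rw [abs_of_nonneg (sub_nonneg.2 (hmono h))]
    have := hup g hg x h
    have : 0 < C * B := by positivity
    linarith
  · rw [abs_of_nonpos (sub_nonpos.2 (hmono h))]
    have hs : x ≤ act Φ g⁻¹ x := by simpa [act_inv_act] using (act_strictMono Φ g⁻¹).monotone h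
    have h1 := hup g⁻¹ (hw.inv_mem g hg) x hs
    have h2 := weight_mul_sub_le hw hmono (hst.avg_primitive hw) hg hs
    rw [act_act_inv] at h2
    have h3 : 0 ≤ F x - F (act Φ g x) := sub_nonneg.2 (hmono h)
    have h4 : F x - F (act Φ g x) ≤ C * B := by
      calc F x - F (act Φ g x) ≤ C * w g * (F x - F (act Φ g x)) :=
            le_mul_of_one_le_left h3 (hC g hg)
        _ = C * (w g * (F x - F (act Φ g x))) := by ring
        _ ≤ C * B := by gcongr; linarith
    linarith

/-- Zero area means zero displacement, so the primitive is invariant; orbits are unbounded, so it is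
constant and `ν` vanishes. -/
theorem area_pos (hfix : ∀ x, ¬ IsGlobalFixedPoint Φ x) (hν : ν ≠ 0) :
    0 < -flux Φ S w ν (primitive ν) 0 := by
  set F := primitive ν with hF
  have hmono : Monotone F := primitive_mono ν
  refine lt_of_le_of_ne (hst.area_nonneg hw) fun h0 => hν ?_
  have hup : ∀ g ∈ S, ∀ x, x ≤ act Φ g x → F (act Φ g x) = F x := by
    intro g hg x hx
    have h1 := hst.sq_le_area hw (hw.inv_mem g hg) (t := x) (by rwa [inv_inv])
    rw [inv_inv, hw.symm, ← hF, ← h0] at h1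
    have h2 := hw.pos g hg
    have h3 : (F (act Φ g x) - F x) ^ 2 ≤ 0 := by
      by_contra! h
      have : 0 < w g ^ 2 / 2 * (F (act Φ g x) - F x) ^ 2 := by positivity
      linarith
    have := pow_eq_zero_iff (two_ne_zero) |>.1 (le_antisymm h3 (sq_nonneg _))
    linarith
  have hS : ∀ g ∈ S, ∀ x, F (act Φ g x) = F x := by
    intro g hg x
    rcases le_total x (act Φ g x) with h | h
    · exact hup g hg x h
    · have := hup g⁻¹ (hw.inv_mem g hg) (act Φ g x) (by rwa [act_inv_act])
      rw [act_inv_act] at this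
      exact this.symm
  have hΓ : ∀ g x, F (act Φ g x) = F x := fun g x =>
    (hw.mem_iff_act_mem (Φ := Φ) (Z := {y | F y = F x}) (fun k hk y hy => by
      exact (hS k hk y).trans hy) g x).1 rfl
  have hcst : ∀ x y, F x ≤ F y := fun x y => by
    obtain ⟨g, hg⟩ := exists_lt_act hfix y x
    exact (hmono hg.le).trans_eq (hΓ g y)
  have hnull : ∀ a b, ν (Set.Ico a b) = 0 := by
    intro a b
    rcases le_total a b with hab | hab
    · have := primitive_sub ν hab
      rw [← hF, le_antisymm (hcst b a) (hcst a b), sub_self] at this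
      exact (measureReal_eq_zero_iff (measure_Ico_ne_top ν a b)).1 this.symm
    · rw [Set.Ico_eq_empty (not_lt.2 hab), measure_empty]
  refine Measure.ext_of_Ico ν 0 fun a b _ => by simp [hnull]

/-- A finite limit would make the quadratic variation tend to zero, below the positive area. -/
theorem tendsto_primitive_atTop (hfix : ∀ x, ¬ IsGlobalFixedPoint Φ x) (hν : ν ≠ 0) :
    Filter.Tendsto (primitive ν) Filter.atTop Filter.atTop := by
  refine Filter.tendsto_atTop_atTop_of_monotone' (primitive_mono ν) fun hb => ?_
  have h1 := tendsto_quadVar (S := S) (w := w) (act_tendsto_atTop Φ)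
    (tendsto_atTop_ciSup (primitive_mono ν) hb)
  have := ge_of_tendsto' h1 (hst.area_le_quadVar hw)
  linarith [hst.area_pos hw hfix hν]

theorem tendsto_primitive_atBot (hfix : ∀ x, ¬ IsGlobalFixedPoint Φ x) (hν : ν ≠ 0) :
    Filter.Tendsto (primitive ν) Filter.atBot Filter.atBot := by
  refine Filter.tendsto_atBot_atBot_of_monotone' (primitive_mono ν) fun hb => ?_
  have h1 := tendsto_quadVar (S := S) (w := w) (act_tendsto_atBot Φ)
    (tendsto_atBot_ciInf (primitive_mono ν) hb)
  have := ge_of_tendsto' h1 (hst.area_le_quadVar hw)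
  linarith [hst.area_pos hw hfix hν]

end StationarySum

end Stationary

end LineAction

namespace LineAction

variable {Γ : Type*} [Group Γ]

/-! ### The maximum principle. -/

section Maximum

variable {Φ : Γ →* HomeoPlus} {S : Finset Γ} {w : Γ → ℝ}

/-- A harmonic function growing slower than a harmonic coordinate `F` of bounded displacement and
quadratic variation bounded from below almost attains its supremum where `F` is small. -/
theorem exists_le_of_sublinear (hw : SymmWeight S w) {F u : ℝ → ℝ} {A B : ℝ}
    (hF : ∀ x, avg Φ S w F x = F x) (hB0 : 0 < B)
    (hB : ∀ g ∈ S, ∀ x, |F (act Φ g x) - F x| ≤ B) (hA0 : 0 < A)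
    (hA : ∀ x, A ≤ quadVar Φ S w F x) (hu : ∀ x, avg Φ S w u x = u x)
    (hsub : ∀ ε > 0, ∃ C, ∀ x, u x ≤ ε * |F x| + C) (x₀ : ℝ) {η : ℝ} (hη : 0 < η) :
    ∃ y, |F y| ≤ B ∧ u x₀ - η ≤ u y := by
  -- The penalty `ε |F|` costs at most `η / 3` at `x₀`, and the correction `δ F ^ 2` at most `η / 3`
  -- where `|F| ≤ M + B`.
  set ε := η / (3 * (|F x₀| + 1)) with hε
  have hε0 : 0 < ε := by positivity
  have hεx : ε * |F x₀| ≤ η / 3 := by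
    rw [hε, div_mul_eq_mul_div, div_le_div_iff₀ (by positivity) (by norm_num)]
    nlinarith [abs_nonneg (F x₀)]
  obtain ⟨C, hC⟩ := hsub (ε / 2) (by positivity)
  set q := |C - u x₀ + ε * (|F x₀|)| with hq
  set M := 2 * (q + 2) / ε + |F x₀| with hM
  have hq0 : 0 ≤ q := abs_nonneg _
  have hM0 : 0 < M := by positivity
  have hMε : ε * M ≥ 2 * (q + 2) := by
    rw [hM, mul_add, mul_div_cancel₀ _ hε0.ne']
    have : 0 ≤ ε * |F x₀| := by positivity
    linarith
  have hMx : |F x₀| ≤ M := by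
    have : 0 ≤ 2 * (q + 2) / ε := by positivity
    linarith
  set δ := min 1 (η / 3) / (M + B) ^ 2 with hδ
  have hδ0 : 0 < δ := by positivity
  have hδM : δ * (M + B) ^ 2 = min 1 (η / 3) := by
    rw [hδ]; field_simp
  -- The term `-ε |F|` beats the growth of `u`, and `δ F ^ 2` makes `v` strictly subharmonic where a
  -- step cannot change the sign of `F`.
  set v : ℝ → ℝ := fun x => u x - ε * |F x| + δ * F x ^ 2 with hv
  have hsq : ∀ x, |F x| ≤ M + B → δ * F x ^ 2 ≤ min 1 (η / 3) := fun x hx => by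
    rw [← hδM, ← sq_abs (F x)]
    gcongr
  have hvC : ∀ x, |F x| ≤ M + B → v x ≤ C + 1 - ε / 2 * |F x| := fun x hx => by
    have h1 := (hsq x hx).trans (min_le_left _ _)
    have h2 := hC x
    simp only [hv]
    linarith
  have hv0 : u x₀ - ε * |F x₀| ≤ v x₀ := by
    simp only [hv]
    have : 0 ≤ δ * F x₀ ^ 2 := by positivity
    linarith
  set D : Set ℝ := {x | |F x| ≤ M + B} with hD
  have hx₀D : x₀ ∈ D := hMx.trans (by linarith)
  have hbdd : BddAbove (v '' D) := by
    refine ⟨C + 1, ?_⟩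
    rintro _ ⟨x, hx, rfl⟩
    have h1 := hvC x hx
    have h2 : 0 ≤ ε / 2 * |F x| := by positivity
    linarith
  set s := sSup (v '' D) with hs
  have hle : ∀ x ∈ D, v x ≤ s := fun x hx => le_csSup hbdd ⟨x, hx, rfl⟩
  -- No continuity is available, so the supremum need not be attained; a point within `δ A` of it
  -- suffices.
  obtain ⟨y, hyD, hys, hyx⟩ : ∃ y ∈ D, s - δ * A < v y ∧ v x₀ ≤ v y := by
    by_cases h : s - δ * A < v x₀
    · exact ⟨x₀, hx₀D, h, le_rfl⟩
    · obtain ⟨_, ⟨y, hy, rfl⟩, hlt⟩ := exists_lt_of_lt_csSup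
        (Set.Nonempty.image v ⟨x₀, hx₀D⟩) (show s - δ * A < s by
          have : 0 < δ * A := by positivity
          linarith)
      exact ⟨y, hy, hlt, (not_lt.1 h).trans hlt.le⟩
  have hyM : |F y| ≤ M := by
    by_contra! h
    have h1 := hvC y hyD
    have h2 : ε * M ≤ ε * |F y| := by gcongr
    have h3 := le_abs_self (C - u x₀ + ε * |F x₀|)
    linarith
  -- Otherwise `|F|` averages to its own value at `y`, so `avg v` exceeds `v` by at least `δ A`
  -- there. One step from `y` stays in `D`, which contradicts the choice of `y`.
  have hyB : |F y| ≤ B := by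
    by_contra! h
    have habs : avg Φ S w (fun x => |F x|) y = |F y| := by
      rcases lt_abs.1 h with hp | hn
      · rw [abs_of_pos (hB0.trans hp), ← hF y]
        refine Finset.sum_congr rfl fun g hg => ?_
        beta_reduce
        rw [abs_of_pos]
        have := (abs_le.1 (hB g hg y)).1
        linarith
      · rw [abs_of_neg (by linarith), ← hF y, avg, avg, ← Finset.sum_neg_distrib]
        refine Finset.sum_congr rfl fun g hg => ?_
        rw [abs_of_neg, mul_neg]
        have := (abs_le.1 (hB g hg y)).2
        linarith
    have hav : avg Φ S w v y = avg Φ S w u y - ε * avg Φ S w (fun x => |F x|) y +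
        δ * avg Φ S w (fun x => F x ^ 2) y := by
      simp only [avg, hv, Finset.mul_sum]
      rw [← Finset.sum_sub_distrib, ← Finset.sum_add_distrib]
      exact Finset.sum_congr rfl fun g _ => by ring
    rw [hu, habs, avg_sq hw hF] at hav
    have h1 : avg Φ S w v y ≤ s := by
      rw [← hw.sum_mul_const s]
      refine Finset.sum_le_sum fun g hg => mul_le_mul_of_nonneg_left (hle _ ?_) (hw.pos g hg).le
      have h2 := abs_add_le (F (act Φ g y) - F y) (F y)
      rw [sub_add_cancel] at h2
      have h3 := hB g hg y
      change |F (act Φ g y)| ≤ M + B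
      linarith
    have h4 : δ * A ≤ δ * quadVar Φ S w F y := by gcongr; exact hA y
    have h5 : v y = u y - ε * |F y| + δ * F y ^ 2 := rfl
    linarith
  refine ⟨y, hyB, ?_⟩
  have h1 := (hsq y hyD).trans (min_le_right _ _)
  have h2 : v y = u y - ε * |F y| + δ * F y ^ 2 := rfl
  have h3 : 0 ≤ ε * |F y| := by positivity
  linarith

theorem exists_abs_le {F : ℝ → ℝ} (hF : Monotone F)
    (ht : Filter.Tendsto F Filter.atTop Filter.atTop)
    (hb : Filter.Tendsto F Filter.atBot Filter.atBot) (B : ℝ) :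
    ∃ a b, ∀ y, |F y| ≤ B → y ∈ Set.Icc a b := by
  obtain ⟨b, hb'⟩ := (ht.eventually_gt_atTop B).exists
  obtain ⟨a, ha'⟩ := (hb.eventually_lt_atBot (-B)).exists
  refine ⟨a, b, fun y hy => ⟨?_, ?_⟩⟩
  · by_contra! h
    have := hF h.le
    linarith [(abs_le.1 hy).1]
  · by_contra! h
    have := hF h.le
    linarith [(abs_le.1 hy).2]

end Maximum

/-! ### Discrete orbits from disjoint invariant sets. -/

section DiscreteOrbit

variable {Φ : Γ →* HomeoPlus}

theorem IsGlobalFixedPoint.hasDiscreteOrbit {x : ℝ} (hx : IsGlobalFixedPoint Φ x) :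
    HasDiscreteOrbit Φ x := fun _ _ =>
  (Set.finite_singleton x).subset fun _ hy => by
    obtain ⟨⟨g, rfl⟩, _⟩ := hy
    exact hx g

/-- Disjoint closed invariant sets force a discrete orbit: the right ends of the gaps of one set
containing points of the other can only accumulate at a common point. -/
theorem exists_hasDiscreteOrbit {Z Z' : Set ℝ} (hZc : IsClosed Z) (hZ'c : IsClosed Z')
    (hZ : ∀ g, ∀ x ∈ Z, act Φ g x ∈ Z) (hZ' : ∀ g, ∀ x ∈ Z', act Φ g x ∈ Z')
    (hne : Z.Nonempty) (hne' : Z'.Nonempty) (hdisj : Disjoint Z Z') :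
    ∃ x, HasDiscreteOrbit Φ x := by
  by_cases hfix : ∃ x, IsGlobalFixedPoint Φ x
  · obtain ⟨x, hx⟩ := hfix
    exact ⟨x, hx.hasDiscreteOrbit⟩
  push Not at hfix
  obtain ⟨z, hz⟩ := hne
  obtain ⟨x, hx⟩ := hne'
  obtain ⟨k, hk⟩ := exists_lt_act hfix z x
  have hcl : IsClosed (Z ∩ Set.Ici x) := hZc.inter isClosed_Ici
  have hbb : BddBelow (Z ∩ Set.Ici x) := ⟨x, fun y hy => hy.2⟩
  -- `[x, β)` misses `Z` and starts in `Z'`, and so do all its translates.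
  set β := sInf (Z ∩ Set.Ici x) with hβ
  have hβmem : β ∈ Z ∩ Set.Ici x := hcl.csInf_mem ⟨_, hZ k z hz, hk.le⟩ hbb
  have hxβ : x < β := lt_of_le_of_ne hβmem.2 fun h =>
    Set.disjoint_left.1 hdisj hβmem.1 (h ▸ hx)
  have hgap : ∀ g, ∀ y ∈ Z, y < act Φ g β → y < act Φ g x := by
    intro g y hy hlt
    by_contra! h
    have h1 : act Φ g⁻¹ y ∈ Z ∩ Set.Ici x := by
      refine ⟨hZ _ _ hy, ?_⟩
      rw [Set.mem_Ici, le_act_iff, inv_inv]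
      exact h
    have h2 := csInf_le hbb h1
    rw [← hβ, le_act_iff, inv_inv] at h2
    exact absurd hlt (not_lt.2 h2)
  refine ⟨β, fun a b => ?_⟩
  by_contra hinf
  obtain ⟨p, -, hp⟩ := Set.Infinite.exists_accPt_of_subset_isCompact
    (show (orbit Φ β ∩ Set.Icc a b).Infinite from hinf) isCompact_Icc Set.inter_subset_right
  rw [accPt_iff_nhds] at hp
  have horb : ∀ y ∈ orbit Φ β, y ∈ Z := by
    rintro _ ⟨g, rfl⟩
    exact hZ g _ hβmem.1
  have hpZ : p ∈ Z := by
    rw [← hZc.closure_eq, mem_closure_iff_nhds]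
    intro U hU
    obtain ⟨y, hy, -⟩ := hp U hU
    exact ⟨y, hy.1, horb y hy.2.1⟩
  have hpZ' : p ∉ Z' := Set.disjoint_left.1 hdisj hpZ
  obtain ⟨ε, hε, hball⟩ := Metric.isOpen_iff.1 hZ'c.isOpen_compl p hpZ'
  -- A point of `Z` near `p` and below `g β` would trap `g x`, a point of `Z'`, inside the ball.
  have key : ∀ g, ∀ y ∈ Z, |y - p| < ε → |act Φ g β - p| < ε → ¬ y < act Φ g β := by
    intro g y hy h1 h2 hlt
    have h3 := hgap g y hy hlt
    have h4 : act Φ g x < act Φ g β := act_strictMono Φ g hxβ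
    rw [abs_lt] at h1 h2
    refine hball (a := act Φ g x) ?_ (hZ' g x hx)
    rw [Metric.mem_ball, Real.dist_eq, abs_lt]
    constructor <;> linarith
  obtain ⟨_, ⟨hy1, ⟨g, rfl⟩, -⟩, hyp⟩ := hp _ (Metric.ball_mem_nhds p hε)
  rw [Metric.mem_ball, Real.dist_eq] at hy1
  simp only at hy1 hyp
  rcases lt_or_gt_of_ne hyp with hlt | hgt
  · obtain ⟨_, ⟨hy2, ⟨k, rfl⟩, -⟩, hyk⟩ := hp _ (Metric.ball_mem_nhds p (sub_pos.2 hlt))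
    rw [Metric.mem_ball, Real.dist_eq] at hy2
    simp only at hy2
    have h5 : |act Φ g β - p| = p - act Φ g β := by
      rw [abs_of_neg (by linarith)]; ring
    refine key k (act Φ g β) (hZ g _ hβmem.1) hy1 (hy2.trans (by rwa [h5] at hy1)) ?_
    linarith [(abs_lt.1 hy2).1]
  · exact key g p hpZ (by simpa using hε) hy1 hgt

end DiscreteOrbit

/-! ### Absence of atoms. -/

section Atoms

variable {Φ : Γ →* HomeoPlus} {S : Finset Γ} {w : Γ → ℝ} {ν : Measure ℝ}
  [IsLocallyFiniteMeasure ν]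

theorem finite_atoms_ge (ν : Measure ℝ) [IsLocallyFiniteMeasure ν] (a b : ℝ) {r : ℝ} (hr : 0 < r) :
    {y | y ∈ Set.Icc a b ∧ r ≤ ν.real {y}}.Finite := by
  have h := Measure.finite_const_le_meas_of_disjoint_iUnion (ν.restrict (Set.Icc a b))
    (ENNReal.ofReal_pos.2 hr) (As := fun y : ℝ => {y}) (fun y => measurableSet_singleton y)
    (fun x y hxy => by simpa using hxy)
    (ne_top_of_le_ne_top (by simpa using isCompact_Icc.measure_lt_top.ne)
      (measure_mono (Set.subset_univ _)))
  refine h.subset fun y hy => ?_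
  have : ν.restrict (Set.Icc a b) {y} = ν {y} := by
    rw [Measure.restrict_apply (measurableSet_singleton y),
      Set.inter_eq_left.2 (Set.singleton_subset_iff.2 hy.1)]
  change ENNReal.ofReal r ≤ ν.restrict (Set.Icc a b) {y}
  rw [this]
  exact ENNReal.ofReal_le_of_le_toReal hy.2

namespace StationarySum

variable (hst : StationarySum Φ S w ν) (hw : SymmWeight S w)

include hst hw

theorem avg_atom (x : ℝ) : avg Φ S w (fun y => ν.real {y}) x = ν.real {x} := by
  have h := hst.integral_eq hw ((LocBdd.const 1).indicator (measurableSet_singleton x))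
    (a := x) (b := x) (fun y hy => Set.indicator_of_notMem (fun h => hy (by
      rw [Set.mem_singleton_iff] at h; simp [h])) _)
  have key : ∀ g, ∫ y, ({x} : Set ℝ).indicator (fun _ => (1 : ℝ)) (act Φ g y) ∂ν =
      ν.real {act Φ g⁻¹ x} := by
    intro g
    have : (fun y => ({x} : Set ℝ).indicator (fun _ => (1 : ℝ)) (act Φ g y)) =
        ({act Φ g⁻¹ x} : Set ℝ).indicator fun _ => (1 : ℝ) := by
      ext y
      have : act Φ g y = x ↔ y = act Φ g⁻¹ x :=
        ⟨fun h => by rw [← h, act_inv_act], fun h => by rw [h, act_act_inv]⟩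
      simp [Set.indicator_apply, this]
    rw [this, integral_indicator (measurableSet_singleton _)]
    simp [Measure.real]
  simp only [key] at h
  rw [integral_indicator (measurableSet_singleton _), hw.sum_inv fun g => ν.real {act Φ g x}] at h
  simp only [integral_const, measureReal_restrict_apply_univ, smul_eq_mul, mul_one] at h
  exact h.symm

/-- Atom size is a bounded harmonic function. If nonzero, it attains its maximum, because large
atoms are locally finite; its maximum set is then invariant and locally finite, hence contains a
discrete orbit. -/
theorem measure_singleton_eq_zero (hν : ν ≠ 0) (hdisc : ∀ x, ¬ HasDiscreteOrbit Φ x) (x₀ : ℝ) :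
    ν {x₀} = 0 := by
  have hfix : ∀ x, ¬ IsGlobalFixedPoint Φ x := fun x hx => hdisc x hx.hasDiscreteOrbit
  have hmono := primitive_mono ν
  obtain ⟨B, hB0, hB⟩ := hst.exists_displacement_bound hw
  set a : ℝ → ℝ := fun y => ν.real {y} with ha
  have haB : ∀ y, a y ≤ B := by
    intro y
    obtain ⟨g, hg, hy⟩ := hw.exists_mem_lt_act hfix y
    calc a y ≤ ν.real (Set.Ico y (act Φ g y)) :=
          measureReal_mono (Set.singleton_subset_iff.2 ⟨le_rfl, hy⟩) (measure_Ico_ne_top ν _ _)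
      _ = _ := (primitive_sub ν hy.le).symm
      _ ≤ B := (le_abs_self _).trans (hB g hg y)
  have hmax : ∀ x, ∀ η > 0, ∃ y, |primitive ν y| ≤ B ∧ a x - η ≤ a y := fun x η hη =>
    exists_le_of_sublinear hw (hst.avg_primitive hw) hB0 hB (hst.area_pos hw hfix hν)
      (hst.area_le_quadVar hw) (hst.avg_atom hw)
      (fun ε hε => ⟨B, fun x => (haB x).trans (le_add_of_nonneg_left (by positivity))⟩) x hη
  obtain ⟨p, q, hpq⟩ := exists_abs_le hmono (hst.tendsto_primitive_atTop hw hfix hν)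
    (hst.tendsto_primitive_atBot hw hfix hν) B
  by_contra hne
  have hα : 0 < a x₀ := by
    refine lt_of_le_of_ne measureReal_nonneg fun h => hne ?_
    exact (measureReal_eq_zero_iff (measure_singleton_lt_top).ne).1 h.symm
  have hfin := finite_atoms_ge ν p q (half_pos hα)
  obtain ⟨y₀, hy₀, hy₀a⟩ := hmax x₀ (a x₀ / 2) (half_pos hα)
  obtain ⟨m, hm, hmmax⟩ := hfin.exists_maximalFor a _ ⟨y₀, hpq y₀ hy₀, by
    change a x₀ / 2 ≤ a y₀; linarith⟩
  have hglob : ∀ x, a x ≤ a m := by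
    intro x
    by_contra! h
    obtain ⟨y, hy, hya⟩ := hmax x ((a x - a m) / 2) (by linarith)
    have hym : a m < a y := by linarith
    exact absurd (hmmax (j := y) ⟨hpq y hy, hm.2.trans hym.le⟩ hym.le) (not_le.2 hym)
  have horb : ∀ g, a (act Φ g m) = a m := fun g =>
    (hw.mem_iff_act_mem (Φ := Φ) (Z := {y | a y = a m}) (fun k hk y hy => by
      have hy' : a y = a m := hy
      exact (hw.eq_of_le_avg (Φ := Φ) (u := a) (x := y) (fun z => (hglob z).trans_eq hy'.symm)
        (hst.avg_atom hw y).ge k hk).trans hy') g m).1 rfl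
  refine hdisc m fun c d => (finite_atoms_ge ν c d (half_pos hα)).subset ?_
  rintro _ ⟨⟨g, rfl⟩, hg⟩
  exact ⟨hg, hm.2.trans (horb g).ge⟩

end StationarySum

theorem continuous_primitive (h0 : ∀ x, ν {x} = 0) : Continuous (primitive ν) := by
  have : NullSingletonClass ν := ⟨h0⟩
  have hc := intervalIntegral.continuous_primitive (μ := ν) (f := fun _ => (1 : ℝ))
    (fun a b => intervalIntegrable_const (μ := ν)) 0
  have key : ∀ a b : ℝ, ν.real (Set.Ico a b) = ν.real (Set.Ioc a b) := fun a b =>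
    measureReal_congr Ico_ae_eq_Ioc
  convert hc using 2 with x
  rw [intervalIntegral.integral_const', ← key, ← key, primitive]
  split_ifs with h
  · simp [Set.Ico_eq_empty (not_lt.2 h)]
  · simp [Set.Ico_eq_empty (not_lt.2 (not_le.1 h).le)]

end Atoms

end LineAction

/-! ### Uniqueness of the stationary measure. -/

namespace LineAction

variable {Γ : Type*} [Group Γ] {Φ : Γ →* HomeoPlus} {S : Finset Γ} {w : Γ → ℝ} {ν : Measure ℝ}
  [IsLocallyFiniteMeasure ν]

theorem exists_isMax_of_almost {h F : ℝ → ℝ} {B a b : ℝ} (hc : Continuous h)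
    (hK : ∀ y, |F y| ≤ B → y ∈ Set.Icc a b)
    (hsup : ∀ x, ∀ η > 0, ∃ y, |F y| ≤ B ∧ h x - η ≤ h y) : ∃ m, ∀ x, h x ≤ h m := by
  obtain ⟨y₀, hy₀, -⟩ := hsup 0 1 one_pos
  obtain ⟨m, -, hm⟩ := isCompact_Icc.exists_isMaxOn ⟨y₀, hK y₀ hy₀⟩ hc.continuousOn
  refine ⟨m, fun x => le_of_forall_pos_le_add fun η hη => ?_⟩
  obtain ⟨y, hy, hxy⟩ := hsup x η hη
  have : h y ≤ h m := hm (hK y hy)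
  linarith

namespace StationarySum

variable (hst : StationarySum Φ S w ν) (hw : SymmWeight S w)

include hst hw

/-- Without discrete orbits, continuous harmonic functions of sublinear growth are constant. -/
theorem eq_of_sublinear (hν : ν ≠ 0) (hdisc : ∀ x, ¬ HasDiscreteOrbit Φ x) {h : ℝ → ℝ}
    (hc : Continuous h) (hP : ∀ x, avg Φ S w h x = h x)
    (hsub : ∀ ε > 0, ∃ C, ∀ x, |h x| ≤ ε * |primitive ν x| + C) (x y : ℝ) : h x = h y := by
  have hfix : ∀ x, ¬ IsGlobalFixedPoint Φ x := fun x hx => hdisc x hx.hasDiscreteOrbit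
  obtain ⟨B, hB0, hB⟩ := hst.exists_displacement_bound hw
  obtain ⟨p, q, hpq⟩ := exists_abs_le (primitive_mono ν) (hst.tendsto_primitive_atTop hw hfix hν)
    (hst.tendsto_primitive_atBot hw hfix hν) B
  have key : ∀ u : ℝ → ℝ, Continuous u → (∀ x, avg Φ S w u x = u x) →
      (∀ ε > 0, ∃ C, ∀ x, u x ≤ ε * |primitive ν x| + C) →
      ∃ m, (∀ x, u x ≤ u m) ∧ ∀ g, ∀ z ∈ {z | u z = u m}, act Φ g z ∈ {z | u z = u m} := by
    intro u hu hPu hsu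
    obtain ⟨m, hm⟩ := exists_isMax_of_almost hu hpq fun x η hη =>
      exists_le_of_sublinear hw (hst.avg_primitive hw) hB0 hB (hst.area_pos hw hfix hν)
        (hst.area_le_quadVar hw) hPu hsu x hη
    refine ⟨m, hm, fun g z hz => (hw.mem_iff_act_mem (Φ := Φ) (fun k hk y hy => ?_) g z).1 hz⟩
    have hy' : u y = u m := hy
    exact (hw.eq_of_le_avg (fun z => (hm z).trans_eq hy'.symm) (hPu y).ge k hk).trans hy'
  obtain ⟨m, hm, hmi⟩ := key h hc hP fun ε hε => (hsub ε hε).imp fun C hC x =>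
    (le_abs_self _).trans (hC x)
  obtain ⟨n, hn, hni⟩ := key (fun x => -h x) hc.neg
    (fun x => by
      have := avg_linear (Φ := Φ) (S := S) (w := w) h h (-1) 0 x
      simp only [neg_mul, one_mul, zero_mul, add_zero] at this
      rw [this, hP])
    fun ε hε => (hsub ε hε).imp fun C hC x => (neg_le_abs _).trans (hC x)
  by_cases hmn : h m = h n
  · have h1 : ∀ z, h z = h m := fun z =>
      le_antisymm (hm z) (hmn ▸ neg_le_neg_iff.1 (hn z))
    rw [h1 x, h1 y]
  · obtain ⟨z, hz⟩ := exists_hasDiscreteOrbit (isClosed_eq hc continuous_const)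
      (isClosed_eq hc.neg continuous_const) hmi hni ⟨m, rfl⟩ ⟨n, rfl⟩
      (Set.disjoint_left.2 fun z hz hz' => hmn (by
        have h1 : h z = h m := hz
        have h2 : -h z = -h n := hz'
        linarith))
    exact absurd hz (hdisc z)

/-- The flux of `k²` is monotone because `k²` is subharmonic; up to a bounded error it is affine
in `k`. -/
theorem exists_flux_mul_sub_le {k : ℝ → ℝ} (hk : LocBdd k) (hP : ∀ x, avg Φ S w k x = k x)
    {b : ℝ} (hb : ∀ g ∈ S, ∀ t x, crossing Φ g t x ≠ 0 → |k (act Φ g x) - k t| ≤ b) :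
    ∃ C, ∀ x y, x ≤ y → flux Φ S w ν k 0 * (k y - k x) ≤ C := by
  obtain ⟨B, hB0, hB⟩ := hst.exists_displacement_bound hw
  set j := flux Φ S w ν k 0 with hj
  -- Near `t` the recentred square is at most `b ^ 2` on landing points, and each generator carries
  -- at most mass `B` across `t`.
  have hE : ∀ t, |flux Φ S w ν (fun x => (k x - k t) ^ 2) t| ≤ b ^ 2 * B := by
    intro t
    refine (abs_flux_le hw (hk.sub (LocBdd.const (k t))).sq (b := fun _ => b ^ 2)
      fun g hg x hx => ?_).trans ?_
    · rw [abs_pow]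
      exact pow_le_pow_left₀ (abs_nonneg _) (hb g hg t x hx) 2
    · rw [← hw.sum_mul_const (b ^ 2 * B)]
      refine Finset.sum_le_sum fun g hg => mul_le_mul_of_nonneg_left ?_ (hw.pos g hg).le
      exact mul_le_mul_of_nonneg_left (hB _ (hw.inv_mem g hg) t) (sq_nonneg b)
  have hexp : ∀ t, flux Φ S w ν (fun x => (k x - k t) ^ 2) t =
      flux Φ S w ν (fun x => k x ^ 2) t - 2 * k t * j := by
    intro t
    have h1 := flux_linear (Φ := Φ) (S := S) (w := w) (ν := ν)
      (hk.sq.add (hk.const_mul (-2 * k t))) (LocBdd.const 1) 1 (k t ^ 2) t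
    have h2 := flux_linear (Φ := Φ) (S := S) (w := w) (ν := ν) hk.sq hk 1 (-2 * k t) t
    rw [hst.flux_one_eq hw] at h1
    simp only [one_mul, mul_zero, add_zero, mul_one] at h1 h2
    rw [h2, hst.flux_eq hw hk hP t 0, ← hj] at h1
    have h3 : (fun x => (k x - k t) ^ 2) = fun x => k x ^ 2 + -2 * k t * k x + k t ^ 2 := by
      ext x; ring
    rw [h3, h1]
    ring
  refine ⟨b ^ 2 * B, fun x y hxy => ?_⟩
  have h1 := hst.flux_sub_flux hw hk.sq hxy
  have h2 : 0 ≤ ∫ z in Set.Ico x y, (avg Φ S w (fun x => k x ^ 2) z - k z ^ 2) ∂ν :=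
    integral_nonneg fun z => by
      simp only [avg_sq hw hP, add_sub_cancel_left]
      exact quadVar_nonneg hw k z
  have hx := (abs_le.1 (hE x)).2
  have hy := (abs_le.1 (hE y)).1
  rw [hexp] at hx hy
  linarith

/-- The slope `c` is the one for which `H - c F` has zero flux. -/
theorem exists_affine {ν' : Measure ℝ} [IsLocallyFiniteMeasure ν']
    (hst' : StationarySum Φ S w ν') (hν : ν ≠ 0) (hν' : ν' ≠ 0)
    (hdisc : ∀ x, ¬ HasDiscreteOrbit Φ x) :
    ∃ c : ℝ, ∀ x y, primitive ν' y - primitive ν' x = c * (primitive ν y - primitive ν x) := by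
  have hfix : ∀ x, ¬ IsGlobalFixedPoint Φ x := fun x hx => hdisc x hx.hasDiscreteOrbit
  set F := primitive ν with hF
  set H := primitive ν' with hH
  set A := -flux Φ S w ν F 0 with hA
  have hA0 : 0 < A := hst.area_pos hw hfix hν
  obtain ⟨B, hB0, hB⟩ := hst.exists_displacement_bound hw
  obtain ⟨B', hB'0, hB'⟩ := hst'.exists_displacement_bound hw
  set c := -flux Φ S w ν H 0 / A with hc
  -- `H - s F` has flux `(s - c) * A`. At `s = c` the estimate says nothing; it is used at `s = c ±
  -- ε`, where it bounds the oscillation of `H - c F` from both sides.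
  have hstep : ∀ s : ℝ, ∃ C, ∀ x y, x ≤ y →
      (s - c) * A * (H y - s * F y - (H x - s * F x)) ≤ C := by
    intro s
    have hk : LocBdd fun x => 1 * H x + -s * F x :=
      (locBdd_primitive.const_mul 1).add (locBdd_primitive.const_mul (-s))
    have hP : ∀ x, avg Φ S w (fun x => 1 * H x + -s * F x) x = 1 * H x + -s * F x := fun x => by
      rw [avg_linear, hst.avg_primitive hw, hst'.avg_primitive hw]
    obtain ⟨C, hC⟩ := hst.exists_flux_mul_sub_le hw hk hP (b := B' + |s| * B)
      (fun g hg t x hx => by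
        have h1 := (abs_sub_le_of_crossing (primitive_mono ν) g hx).trans (hB g hg t)
        have h2 := (abs_sub_le_of_crossing (primitive_mono ν') g hx).trans (hB' g hg t)
        have e : 1 * H (act Φ g x) + -s * F (act Φ g x) - (1 * H t + -s * F t) =
            (H (act Φ g x) - H t) - s * (F (act Φ g x) - F t) := by ring
        rw [e]
        refine (abs_sub _ _).trans (add_le_add h2 ?_)
        rw [abs_mul]
        gcongr)
    refine ⟨C, fun x y hxy => le_trans (le_of_eq ?_) (hC x y hxy)⟩
    rw [flux_linear locBdd_primitive locBdd_primitive]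
    have e1 : flux Φ S w ν H 0 = -c * A := by
      rw [hc]; field_simp
    have e2 : flux Φ S w ν F 0 = -A := by rw [hA]; ring
    rw [← hH, ← hF, e1, e2]
    ring
  set h : ℝ → ℝ := fun x => H x - c * F x with hh
  have hcont : Continuous h :=
    (continuous_primitive (hst'.measure_singleton_eq_zero hw hν' hdisc)).sub
      ((continuous_primitive (hst.measure_singleton_eq_zero hw hν hdisc)).const_mul c)
  have hP : ∀ x, avg Φ S w h x = h x := fun x => by
    have := avg_linear (Φ := Φ) (S := S) (w := w) H F 1 (-c) x
    rw [hst.avg_primitive hw, hst'.avg_primitive hw] at this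
    simpa [hh, sub_eq_add_neg] using this
  have hosc : ∀ ε > 0, ∃ C, ∀ x y, x ≤ y → |h y - h x| ≤ ε * (F y - F x) + C := by
    intro ε hε
    obtain ⟨C₁, h₁⟩ := hstep (c + ε)
    obtain ⟨C₂, h₂⟩ := hstep (c - ε)
    refine ⟨max C₁ C₂ / (ε * A), fun x y hxy => ?_⟩
    have hεA : 0 < ε * A := by positivity
    have i₁ : (h y - h x) - ε * (F y - F x) ≤ max C₁ C₂ / (ε * A) := by
      rw [le_div_iff₀ hεA]
      refine le_trans (le_of_eq ?_) ((h₁ x y hxy).trans (le_max_left _ _))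
      simp only [hh]; ring
    have i₂ : -(h y - h x) - ε * (F y - F x) ≤ max C₁ C₂ / (ε * A) := by
      rw [le_div_iff₀ hεA]
      refine le_trans (le_of_eq ?_) ((h₂ x y hxy).trans (le_max_right _ _))
      simp only [hh]; ring
    rw [abs_le]
    constructor <;> linarith
  have hsub : ∀ ε > 0, ∃ C, ∀ x, |h x| ≤ ε * |F x| + C := by
    intro ε hε
    obtain ⟨C, hC⟩ := hosc ε hε
    refine ⟨C + |h 0| + ε * |F 0|, fun x => ?_⟩
    have h1 : |h x - h 0| ≤ ε * |F x - F 0| + C := by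
      rcases le_total 0 x with hx | hx
      · exact (hC 0 x hx).trans (by gcongr; exact le_abs_self _)
      · rw [abs_sub_comm, abs_sub_comm (F x)]
        exact (hC x 0 hx).trans (by gcongr; exact le_abs_self _)
    have h2 : ε * |F x - F 0| ≤ ε * |F x| + ε * |F 0| := by
      rw [← mul_add]
      gcongr
      exact abs_sub _ _
    have h3 := abs_add_le (h x - h 0) (h 0)
    rw [sub_add_cancel] at h3
    linarith
  refine ⟨c, fun x y => ?_⟩
  have := hst.eq_of_sublinear hw hν hdisc hcont hP hsub x y
  simp only [hh] at this
  linarith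

/-- Uniqueness of the stationary measure up to scaling. -/
theorem exists_eq_smul {ν' : Measure ℝ} [IsLocallyFiniteMeasure ν']
    (hst' : StationarySum Φ S w ν') (hν : ν ≠ 0) (hν' : ν' ≠ 0)
    (hdisc : ∀ x, ¬ HasDiscreteOrbit Φ x) : ∃ c : ℝ≥0, 0 < c ∧ ν' = c • ν := by
  obtain ⟨c, hc⟩ := hst.exists_affine hw hst' hν hν' hdisc
  have hreal : ∀ a b, a ≤ b → ν'.real (Set.Ico a b) = c * ν.real (Set.Ico a b) :=
    fun a b hab => by rw [← primitive_sub ν' hab, ← primitive_sub ν hab, hc]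
  obtain ⟨a, b, hab, hne⟩ : ∃ a b, a < b ∧ ν' (Set.Ico a b) ≠ 0 := by
    by_contra! H
    exact hν' (Measure.ext_of_Ico ν' 0 fun a b hab => by simpa using H a b hab)
  have hc0 : 0 < c := by
    have h1 : 0 < ν'.real (Set.Ico a b) :=
      (measureReal_ne_zero_iff (measure_Ico_ne_top ν' a b)).2 hne |>.symm.lt_of_le
        measureReal_nonneg
    rw [hreal a b hab.le] at h1
    exact pos_of_mul_pos_left h1 measureReal_nonneg
  refine ⟨c.toNNReal, Real.toNNReal_pos.2 hc0, Measure.ext_of_Ico ν' _ fun a b hab => ?_⟩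
  rw [Measure.smul_apply, ENNReal.smul_def, smul_eq_mul,
    ← ENNReal.toReal_eq_toReal_iff' (measure_Ico_ne_top ν' a b)
      (ENNReal.mul_ne_top ENNReal.coe_ne_top (measure_Ico_ne_top ν a b)), ENNReal.toReal_mul,
    ENNReal.coe_toReal, Real.coe_toNNReal c hc0.le]
  exact hreal a b hab.le

end StationarySum

end LineAction

/-! ### Existence: Dirichlet problems and the Harnack inequality. -/

namespace LineAction

variable {Γ : Type*} [Group Γ] {Φ : Γ →* HomeoPlus} {S : Finset Γ} {w : Γ → ℝ}

theorem avg_mono (hw : SymmWeight S w) {u v : ℝ → ℝ} (huv : ∀ x, u x ≤ v x) (x : ℝ) :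
    avg Φ S w u x ≤ avg Φ S w v x :=
  Finset.sum_le_sum fun g hg => mul_le_mul_of_nonneg_left (huv _) (hw.pos g hg).le

theorem monotone_avg (hw : SymmWeight S w) {u : ℝ → ℝ} (hu : Monotone u) :
    Monotone (avg Φ S w u) := fun _ _ hxy =>
  Finset.sum_le_sum fun g hg =>
    mul_le_mul_of_nonneg_left (hu ((act_strictMono Φ g).monotone hxy)) (hw.pos g hg).le

theorem tendsto_avg_of_forall {ι : Type*} {l : Filter ι} {u : ι → ℝ → ℝ} {v : ℝ → ℝ}
    (h : ∀ x, Filter.Tendsto (fun i => u i x) l (nhds (v x))) (x : ℝ) :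
    Filter.Tendsto (fun i => avg Φ S w (u i) x) l (nhds (avg Φ S w v x)) :=
  tendsto_finsetSum S fun g _ => (h (act Φ g x)).const_mul (w g)

/-- The Dirichlet problem on `[-N, N]`, with boundary values `0` on the left and `1` on the
right, has a monotone solution. -/
theorem exists_dirichlet (Φ : Γ →* HomeoPlus) (hw : SymmWeight S w) {N : ℝ} (hN : 0 ≤ N) :
    ∃ u : ℝ → ℝ, Monotone u ∧ (∀ x < -N, u x = 0) ∧ (∀ x, N < x → u x = 1) ∧
      ∀ x, -N ≤ x → x ≤ N → avg Φ S w u x = u x := by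
  set T : (ℝ → ℝ) → ℝ → ℝ := fun u x =>
    if x < -N then 0 else if N < x then 1 else avg Φ S w u x with hT
  have hT01 : ∀ u : ℝ → ℝ, (∀ x, u x ∈ Set.Icc 0 1) → ∀ x, T u x ∈ Set.Icc 0 1 := by
    intro u hu x
    simp only [hT]
    split_ifs
    · simp
    · simp
    · refine ⟨?_, ?_⟩
      · simpa [avg] using avg_mono (Φ := Φ) hw (u := fun _ => 0) (fun y => (hu y).1) x
      · rw [← hw.sum_mul_const 1]
        exact avg_mono (Φ := Φ) hw (v := fun _ => 1) (fun y => (hu y).2) x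
  have hTle : ∀ u v : ℝ → ℝ, (∀ x, u x ≤ v x) → ∀ x, T u x ≤ T v x := by
    intro u v huv x
    simp only [hT]
    split_ifs
    · exact le_rfl
    · exact le_rfl
    · exact avg_mono hw huv x
  have hTmono : ∀ u : ℝ → ℝ, (∀ x, u x ∈ Set.Icc 0 1) → Monotone u → Monotone (T u) := by
    intro u hu hm x y hxy
    by_cases h1 : x < -N
    · have : T u x = 0 := by simp [hT, h1]
      rw [this]
      exact (hT01 u hu y).1
    by_cases h2 : N < y
    · have : T u y = 1 := by simp [hT, h2, show ¬ y < -N by linarith]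
      rw [this]
      exact (hT01 u hu x).2
    · simp only [hT, h1, h2, show ¬ y < -N by linarith, show ¬ N < x by linarith, if_false]
      exact monotone_avg hw hm hxy
  -- Iterates from zero increase and stay below one; `avg` is a finite sum, so it passes to their
  -- pointwise limit.
  set v : ℕ → ℝ → ℝ := fun n => T^[n] (fun _ => 0) with hv
  have hvs : ∀ n, v (n + 1) = T (v n) := fun n => Function.iterate_succ_apply' T n _
  have hv01 : ∀ n x, v n x ∈ Set.Icc 0 1 := by
    intro n
    induction n with
    | zero => simp [hv]
    | succ n ih => rw [hvs]; exact hT01 _ ih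
  have hvm : ∀ n, Monotone (v n) := by
    intro n
    induction n with
    | zero => exact monotone_const
    | succ n ih => rw [hvs]; exact hTmono _ (hv01 n) ih
  have hvle : ∀ n x, v n x ≤ v (n + 1) x := by
    intro n
    induction n with
    | zero => exact fun x => (hv01 1 x).1
    | succ n ih => rw [hvs, hvs (n + 1)]; exact hTle _ _ ih
  have hb : ∀ x, BddAbove (Set.range fun n => v n x) := fun x =>
    ⟨1, by rintro _ ⟨n, rfl⟩; exact (hv01 n x).2⟩
  set u : ℝ → ℝ := fun x => ⨆ n, v n x with hu
  have hlim : ∀ x, Filter.Tendsto (fun n => v n x) Filter.atTop (nhds (u x)) := fun x =>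
    tendsto_atTop_ciSup (monotone_nat_of_le_succ fun n => hvle n x) (hb x)
  have hTu : ∀ x, T u x = u x := by
    intro x
    refine tendsto_nhds_unique (f := fun n => v (n + 1) x) ?_
      ((hlim x).comp (Filter.tendsto_add_atTop_nat 1))
    simp only [hvs, hT]
    split_ifs
    · exact tendsto_const_nhds
    · exact tendsto_const_nhds
    · exact tendsto_avg_of_forall hlim x
  refine ⟨u, fun x y hxy => ciSup_mono (hb y) fun n => hvm n hxy, fun x hx => ?_, fun x hx => ?_,
    fun x h1 h2 => ?_⟩
  · rw [← hTu]; simp [hT, hx]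
  · rw [← hTu]; simp [hT, hx, show ¬ x < -N by linarith]
  · rw [← hTu x]; simp [hT, not_lt.2 h1, not_lt.2 h2]

/-- The farthest points reachable from `0`, one step at a time. A finite limit of the sequence would
be moved up by some generator and overtaken. -/
theorem exists_upper_seq (hw : SymmWeight S w) (hfix : ∀ x, ¬ IsGlobalFixedPoint Φ x) :
    ∃ q : ℕ → ℝ, q 0 = 0 ∧ (∀ n, ∀ g ∈ S, act Φ g (q n) ≤ q (n + 1)) ∧
      (∀ n, ∃ g ∈ S, act Φ g (q n) = q (n + 1)) ∧ Monotone q ∧ ∀ b, ∃ n, b < q n := by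
  set M : ℝ → ℝ := fun t => S.sup' hw.nonempty fun g => act Φ g t with hM
  set q : ℕ → ℝ := fun n => M^[n] 0 with hq
  have hqs : ∀ n, q (n + 1) = M (q n) := fun n => Function.iterate_succ_apply' M n _
  have hle : ∀ n, ∀ g ∈ S, act Φ g (q n) ≤ q (n + 1) := fun n g hg => by
    rw [hqs]
    exact Finset.le_sup' (fun g => act Φ g (q n)) hg
  have hmono : Monotone q := monotone_nat_of_le_succ fun n => by
    obtain ⟨g, hg, h⟩ := hw.exists_mem_lt_act hfix (q n)
    exact h.le.trans (hle n g hg)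
  refine ⟨q, rfl, hle, fun n => ?_, hmono, fun b => ?_⟩
  · obtain ⟨g, hg, h⟩ := Finset.exists_mem_eq_sup' hw.nonempty fun g => act Φ g (q n)
    exact ⟨g, hg, by rw [hqs, ← h]⟩
  · by_contra! H
    have hb : BddAbove (Set.range q) := ⟨b, by rintro _ ⟨n, rfl⟩; exact H n⟩
    set L := sSup (Set.range q)
    obtain ⟨g, hg, h⟩ := hw.exists_mem_lt_act hfix L
    have h1 : act Φ g⁻¹ L < L := by rwa [act_lt_iff, inv_inv]
    obtain ⟨_, ⟨n, rfl⟩, hn⟩ := exists_lt_of_lt_csSup (Set.range_nonempty q) h1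
    rw [act_lt_iff, inv_inv] at hn
    exact absurd (le_csSup hb ⟨n + 1, rfl⟩) (not_le.2 (hn.trans_le (hle n g hg)))

theorem exists_lower_seq (hw : SymmWeight S w) (hfix : ∀ x, ¬ IsGlobalFixedPoint Φ x) :
    ∃ q : ℕ → ℝ, q 0 = 0 ∧ (∀ n, ∀ g ∈ S, q (n + 1) ≤ act Φ g (q n)) ∧
      (∀ n, ∃ g ∈ S, act Φ g (q n) = q (n + 1)) ∧ Antitone q ∧ ∀ b, ∃ n, q n < b := by
  set M : ℝ → ℝ := fun t => S.inf' hw.nonempty fun g => act Φ g t with hM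
  set q : ℕ → ℝ := fun n => M^[n] 0 with hq
  have hqs : ∀ n, q (n + 1) = M (q n) := fun n => Function.iterate_succ_apply' M n _
  have hle : ∀ n, ∀ g ∈ S, q (n + 1) ≤ act Φ g (q n) := fun n g hg => by
    rw [hqs]
    exact Finset.inf'_le (fun g => act Φ g (q n)) hg
  have hmono : Antitone q := antitone_nat_of_succ_le fun n => by
    obtain ⟨g, hg, h⟩ := hw.exists_mem_act_lt hfix (q n)
    exact (hle n g hg).trans h.le
  refine ⟨q, rfl, hle, fun n => ?_, hmono, fun b => ?_⟩
  · obtain ⟨g, hg, h⟩ := Finset.exists_mem_eq_inf' hw.nonempty fun g => act Φ g (q n)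
    exact ⟨g, hg, by rw [hqs, ← h]⟩
  · by_contra! H
    have hb : BddBelow (Set.range q) := ⟨b, by rintro _ ⟨n, rfl⟩; exact H n⟩
    set L := sInf (Set.range q)
    obtain ⟨g, hg, h⟩ := hw.exists_mem_act_lt hfix L
    have h1 : L < act Φ g⁻¹ L := by rwa [← act_lt_iff]
    obtain ⟨_, ⟨n, rfl⟩, hn⟩ := exists_lt_of_csInf_lt (Set.range_nonempty q) h1
    rw [← act_lt_iff] at hn
    exact absurd (csInf_le hb ⟨n + 1, rfl⟩) (not_le.2 ((hle n g hg).trans_lt hn))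

/-- Above the floor `l` all terms of the average of `u - u l` are nonnegative, so each is at most
`C` times the total. -/
theorem harnack_upper (hw : SymmWeight S w) {C : ℝ} (hC0 : 0 < C) (hC : ∀ g ∈ S, 1 ≤ C * w g)
    {u : ℝ → ℝ} (hu : Monotone u) {t l : ℝ} (hP : avg Φ S w u t = u t)
    (hl : ∀ g ∈ S, l ≤ act Φ g t) {g : Γ} (hg : g ∈ S) :
    u (act Φ g t) - u l ≤ C * (u t - u l) := by
  have h0 : 0 ≤ u (act Φ g t) - u l := sub_nonneg.2 (hu (hl g hg))
  have h1 : w g * (u (act Φ g t) - u l) ≤ ∑ k ∈ S, w k * (u (act Φ k t) - u l) :=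
    Finset.single_le_sum (f := fun k => w k * (u (act Φ k t) - u l))
      (fun k hk => mul_nonneg (hw.pos k hk).le (sub_nonneg.2 (hu (hl k hk)))) hg
  have h2 : ∑ k ∈ S, w k * (u (act Φ k t) - u l) = u t - u l := by
    simp only [mul_sub, Finset.sum_sub_distrib, hw.sum_mul_const]
    rw [← hP]
    rfl
  calc u (act Φ g t) - u l ≤ C * w g * (u (act Φ g t) - u l) := le_mul_of_one_le_left h0 (hC g hg)
    _ = C * (w g * (u (act Φ g t) - u l)) := by ring
    _ ≤ C * (u t - u l) := by rw [← h2]; gcongr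

theorem harnack_lower (hw : SymmWeight S w) {C : ℝ} (hC0 : 0 < C) (hC : ∀ g ∈ S, 1 ≤ C * w g)
    {u : ℝ → ℝ} (hu : Monotone u) {t l : ℝ} (hP : avg Φ S w u t = u t)
    (hl : ∀ g ∈ S, act Φ g t ≤ l) {g : Γ} (hg : g ∈ S) :
    u l - u (act Φ g t) ≤ C * (u l - u t) := by
  have h0 : 0 ≤ u l - u (act Φ g t) := sub_nonneg.2 (hu (hl g hg))
  have h1 : w g * (u l - u (act Φ g t)) ≤ ∑ k ∈ S, w k * (u l - u (act Φ k t)) :=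
    Finset.single_le_sum (f := fun k => w k * (u l - u (act Φ k t)))
      (fun k hk => mul_nonneg (hw.pos k hk).le (sub_nonneg.2 (hu (hl k hk)))) hg
  have h2 : ∑ k ∈ S, w k * (u l - u (act Φ k t)) = u l - u t := by
    simp only [mul_sub, Finset.sum_sub_distrib, hw.sum_mul_const]
    rw [← hP]
    rfl
  calc u l - u (act Φ g t) ≤ C * w g * (u l - u (act Φ g t)) := le_mul_of_one_le_left h0 (hC g hg)
    _ = C * (w g * (u l - u (act Φ g t))) := by ring
    _ ≤ C * (u l - u t) := by rw [← h2]; gcongr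

/-- A nonconstant monotone harmonic function on the line. -/
theorem exists_monotone_harmonic (hw : SymmWeight S w) (hfix : ∀ x, ¬ IsGlobalFixedPoint Φ x) :
    ∃ F : ℝ → ℝ, Monotone F ∧ (∀ x, avg Φ S w F x = F x) ∧ ∃ p q, F p < F q := by
  obtain ⟨q, hq0, hqle, hqex, hqm, hqu⟩ := exists_upper_seq hw hfix
  obtain ⟨p, hp0, hple, hpex, hpm, hpu⟩ := exists_lower_seq hw hfix
  obtain ⟨C, hC0, hC⟩ := hw.exists_inv_le
  have hq0' : ∀ n, 0 ≤ q n := fun n => hq0 ▸ hqm n.zero_le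
  have hp0' : ∀ n, p n ≤ 0 := fun n => hp0 ▸ hpm n.zero_le
  -- The floor is `p 1` because one step from a point `≥ 0` cannot land below it. The bound is
  -- independent of `N`.
  have hup : ∀ (u : ℝ → ℝ) (N : ℝ), Monotone u →
      (∀ x, -N ≤ x → x ≤ N → avg Φ S w u x = u x) → ∀ n, q n ≤ N →
      u (q (n + 1)) - u (p 1) ≤ C ^ n * (u (q 1) - u (p 1)) := by
    intro u N hu hP n
    induction n with
    | zero => simp
    | succ n ih =>
      intro hn
      have h1 := ih ((hqm n.le_succ).trans hn)
      obtain ⟨g, hg, hgq⟩ := hqex (n + 1)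
      have h2 := harnack_upper hw hC0 hC hu (t := q (n + 1)) (l := p 1)
        (hP _ (by linarith [hq0' (n + 1)]) hn) (fun k hk => by
          refine (hple 0 k hk).trans ((act_strictMono Φ k).monotone ?_)
          rw [hp0]
          exact hq0' _) hg
      rw [hgq] at h2
      calc _ ≤ _ := h2
        _ ≤ C * (C ^ n * (u (q 1) - u (p 1))) := by gcongr
        _ = _ := by ring
  have hlo : ∀ (u : ℝ → ℝ) (N : ℝ), Monotone u →
      (∀ x, -N ≤ x → x ≤ N → avg Φ S w u x = u x) → ∀ n, -N ≤ p n →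
      u (q 1) - u (p (n + 1)) ≤ C ^ n * (u (q 1) - u (p 1)) := by
    intro u N hu hP n
    induction n with
    | zero => simp
    | succ n ih =>
      intro hn
      have h1 := ih (hn.trans (hpm n.le_succ))
      obtain ⟨g, hg, hgp⟩ := hpex (n + 1)
      have h2 := harnack_lower hw hC0 hC hu (t := p (n + 1)) (l := q 1)
        (hP _ hn (by linarith [hp0' (n + 1)])) (fun k hk => by
          refine le_trans ((act_strictMono Φ k).monotone ?_) (hqle 0 k hk)
          rw [hq0]
          exact hp0' _) hg
      rw [hgp] at h2
      calc _ ≤ _ := h2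
        _ ≤ C * (C ^ n * (u (q 1) - u (p 1))) := by gcongr
        _ = _ := by ring
  have hsol : ∀ N : ℕ, ∃ f : ℝ → ℝ, Monotone f ∧ f (p 1) = 0 ∧ f (q 1) = 1 ∧
      ∀ x, -(N : ℝ) ≤ x → x ≤ N → avg Φ S w f x = f x := by
    intro N
    obtain ⟨u, hu, hu0, hu1, hP⟩ := exists_dirichlet Φ hw (Nat.cast_nonneg (α := ℝ) N)
    have hle : u (p 1) ≤ u (q 1) := hu ((hp0' 1).trans (hq0' 1))
    -- If equality held, Harnack up to the first `q` beyond `N`, where `u = 1`, would give `u (p 1)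
    -- ≥ 1`; the lower sequence would give `u (q 1) ≤ 0`.
    have hlt : u (p 1) < u (q 1) := by
      refine lt_of_le_of_ne hle fun heq => ?_
      have h1 : 1 ≤ u (p 1) := by
        classical
        have hex := hqu N
        obtain ⟨m, hm⟩ : ∃ m, Nat.find hex = m + 1 := Nat.exists_eq_succ_of_ne_zero fun h0 => by
          have := Nat.find_spec hex
          rw [h0, hq0] at this
          exact absurd this (not_lt.2 (Nat.cast_nonneg N))
        have hmN : q m ≤ N := not_lt.1 (Nat.find_min hex (by omega))
        have h2 := hup u N hu hP m hmN
        have h3 := Nat.find_spec hex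
        rw [hm] at h3
        rw [hu1 _ h3, heq, sub_self, mul_zero] at h2
        linarith
      have h1' : u (q 1) ≤ 0 := by
        classical
        have hex := hpu (-N)
        obtain ⟨m, hm⟩ : ∃ m, Nat.find hex = m + 1 := Nat.exists_eq_succ_of_ne_zero fun h0 => by
          have := Nat.find_spec hex
          rw [h0, hp0] at this
          have : (0 : ℝ) ≤ N := Nat.cast_nonneg N
          linarith
        have hmN : -(N : ℝ) ≤ p m := not_lt.1 (Nat.find_min hex (by omega))
        have h2 := hlo u N hu hP m hmN
        have h3 := Nat.find_spec hex
        rw [hm] at h3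
        rw [hu0 _ h3, heq, sub_self, mul_zero] at h2
        linarith
      linarith
    have hd : 0 < u (q 1) - u (p 1) := sub_pos.2 hlt
    refine ⟨fun x => (u x - u (p 1)) / (u (q 1) - u (p 1)), fun x y hxy => ?_, by simp,
      div_self hd.ne', fun x h1 h2 => ?_⟩
    · have := hu hxy
      simp only
      gcongr
    · change _ = (u x - u (p 1)) / _
      rw [← hP x h1 h2]
      simp only [avg, ← mul_div_assoc, ← Finset.sum_div, mul_sub, Finset.sum_sub_distrib,
        hw.sum_mul_const]
  choose f hfm hf0 hf1 hfP using hsol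
  -- The Harnack bounds make `f N x` eventually bounded for each `x`; a nonprincipal ultrafilter
  -- selects all pointwise limits at once.
  have hev : ∀ b : ℝ, ∀ᶠ N : ℕ in (Filter.hyperfilter ℕ : Filter ℕ), b ≤ N := fun b =>
    Filter.Tendsto.eventually_ge_atTop
      (tendsto_natCast_atTop_atTop.mono_left Nat.hyperfilter_le_atTop) b
  have hlim : ∀ x, ∃ L, Filter.Tendsto (fun N => f N x) (Filter.hyperfilter ℕ : Filter ℕ)
      (nhds L) := by
    intro x
    obtain ⟨n, hn⟩ := hqu x
    obtain ⟨m, hm⟩ := hpu x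
    have hK : ∀ᶠ N : ℕ in (Filter.hyperfilter ℕ : Filter ℕ),
        f N x ∈ Set.Icc (1 - C ^ m) (C ^ n) := by
      filter_upwards [hev (q n), hev (-p m)] with N h1 h2
      constructor
      · have h3 := hlo (f N) N (hfm N) (hfP N) m (by linarith)
        have h4 := hfm N ((hpm m.le_succ).trans hm.le)
        rw [hf0, hf1] at h3
        simp only [Nat.succ_eq_add_one] at h4
        linarith
      · have h3 := hup (f N) N (hfm N) (hfP N) n h1
        have h4 := hfm N (hn.le.trans (hqm n.le_succ))
        rw [hf0, hf1] at h3
        simp only [Nat.succ_eq_add_one] at h4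
        linarith
    obtain ⟨L, -, hL⟩ := isCompact_Icc.ultrafilter_le_nhds
      ((Filter.hyperfilter ℕ).map fun N => f N x) (Filter.le_principal_iff.2 hK)
    exact ⟨L, hL⟩
  choose F hF using hlim
  refine ⟨F, fun x y hxy => le_of_tendsto_of_tendsto' (hF x) (hF y) fun N => hfm N hxy,
    fun x => ?_, p 1, q 1, ?_⟩
  · refine tendsto_nhds_unique (tendsto_avg_of_forall hF x) ((hF x).congr' ?_)
    filter_upwards [hev x, hev (-x)] with N h1 h2
    exact (hfP N x (by linarith) h1).symm
  · have e0 : F (p 1) = 0 := tendsto_nhds_unique (hF _) (by simp only [hf0]; exact tendsto_const_nhds)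
    have e1 : F (q 1) = 1 := tendsto_nhds_unique (hF _) (by simp only [hf1]; exact tendsto_const_nhds)
    rw [e0, e1]
    exact one_pos

theorem avg_rightLim {F : ℝ → ℝ} (hm : Monotone F) (hP : ∀ x, avg Φ S w F x = F x) (x : ℝ) :
    avg Φ S w (Function.rightLim F) x = Function.rightLim F x := by
  refine tendsto_nhds_unique (f := F) (l := nhdsWithin x (Set.Ioi x)) ?_ (hm.tendsto_rightLim x)
  have : F = fun y => ∑ g ∈ S, w g * F (act Φ g y) := (funext hP).symm
  rw [this]
  refine tendsto_finsetSum S fun g _ => Filter.Tendsto.const_mul (w g) ?_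
  rw [← this]
  refine (hm.tendsto_rightLim _).comp (tendsto_nhdsWithin_iff.2
    ⟨((act_continuous Φ g).tendsto x).mono_left nhdsWithin_le_nhds, ?_⟩)
  filter_upwards [self_mem_nhdsWithin] with y hy using act_strictMono Φ g hy

theorem preimage_act_Ioc (Φ : Γ →* HomeoPlus) (g : Γ) (a b : ℝ) :
    act Φ g ⁻¹' Set.Ioc a b = Set.Ioc (act Φ g⁻¹ a) (act Φ g⁻¹ b) := by
  ext x
  have h1 := act_lt_iff Φ g⁻¹ a x
  have h2 := le_act_iff Φ g⁻¹ b x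
  rw [inv_inv] at h1 h2
  simp [h1, h2]

/-- The right limit of a monotone harmonic function is harmonic and defines a Stieltjes measure;
with symmetry, harmonicity is stationarity on intervals `(a, b]`. -/
theorem exists_stationarySum (hw : SymmWeight S w) (hfix : ∀ x, ¬ IsGlobalFixedPoint Φ x) :
    ∃ ν : Measure ℝ, IsLocallyFiniteMeasure ν ∧ ν ≠ 0 ∧ StationarySum Φ S w ν := by
  obtain ⟨F, hm, hP, p, q, hpq⟩ := exists_monotone_harmonic hw hfix
  have hPG : ∀ x, avg Φ S w hm.stieltjesFunction x = hm.stieltjesFunction x := avg_rightLim hm hP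
  have hGF : ∀ x y, x < y → F x ≤ hm.stieltjesFunction x ∧ hm.stieltjesFunction x ≤ F y :=
    fun x y hxy => ⟨hm.le_rightLim le_rfl, hm.rightLim_le hxy⟩
  set G := hm.stieltjesFunction
  refine ⟨G.measure, inferInstance, fun h0 => ?_, ?_⟩
  · have h1 : G.measure (Set.Ioc (p - 1) q) = 0 := by rw [h0]; simp
    rw [StieltjesFunction.measure_Ioc, ENNReal.ofReal_eq_zero] at h1
    linarith [(hGF (p - 1) p (by linarith)).2, (hGF q (q + 1) (by linarith)).1]
  · refine Measure.ext_of_Ioc _ _ fun a b hab => ?_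
    have h1 : G b - G a = ∑ g ∈ S, w g * (G (act Φ g⁻¹ b) - G (act Φ g⁻¹ a)) := by
      rw [hw.sum_inv fun g => G (act Φ g b) - G (act Φ g a)]
      simp only [mul_sub, Finset.sum_sub_distrib]
      rw [← hPG a, ← hPG b]
      rfl
    rw [Measure.finsetSum_apply, StieltjesFunction.measure_Ioc, h1,
      ENNReal.ofReal_sum_of_nonneg fun g hg => mul_nonneg (hw.pos g hg).le
        (sub_nonneg.2 (G.mono ((act_strictMono Φ g⁻¹).monotone hab.le)))]
    refine Finset.sum_congr rfl fun g hg => ?_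
    rw [Measure.smul_apply, Measure.map_apply (act_measurable Φ g) measurableSet_Ioc,
      preimage_act_Ioc, StieltjesFunction.measure_Ioc, ENNReal.ofReal_mul (hw.pos g hg).le,
      smul_eq_mul]

end LineAction

/-! ### Transfer to `PMF` and conjugacies to harmonic actions. -/

namespace LineAction

variable {Γ : Type*} [Group Γ]

theorem symmWeight_of_pmf {ρ : PMF Γ} (hfin : ρ.support.Finite) (hsymm : ∀ g, ρ g⁻¹ = ρ g)
    (hgen : Subgroup.closure ρ.support = ⊤) :
    SymmWeight hfin.toFinset fun g => (ρ g).toReal where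
  pos g hg := ENNReal.toReal_pos (by simpa using hg) (ρ.apply_ne_top g)
  sum_eq_one := by
    have h : ∑' g, ρ g = ∑ g ∈ hfin.toFinset, ρ g := tsum_eq_sum fun g hg => by simpa using hg
    rw [← ENNReal.toReal_sum fun g _ => ρ.apply_ne_top g, ← h, ρ.tsum_coe, ENNReal.toReal_one]
  inv_mem g hg := by simpa [hsymm] using hg
  symm g := by rw [hsymm]
  gen := by simpa using hgen

theorem isStationary_iff {ρ : PMF Γ} (hfin : ρ.support.Finite) (Φ : Γ →* HomeoPlus)
    (ν : Measure ℝ) :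
    IsStationary ρ Φ ν ↔ StationarySum Φ hfin.toFinset (fun g => (ρ g).toReal) ν := by
  have : (Measure.sum fun g => ρ g • Measure.map (act Φ g) ν) =
      ∑ g ∈ hfin.toFinset, ENNReal.ofReal (ρ g).toReal • Measure.map (act Φ g) ν := by
    ext s hs
    rw [Measure.sum_apply _ hs, Measure.finsetSum_apply, tsum_eq_sum (s := hfin.toFinset)]
    · exact Finset.sum_congr rfl fun g _ => by rw [ENNReal.ofReal_toReal (ρ.apply_ne_top g)]
    · intro g hg
      have : ρ g = 0 := by simpa using hg
      simp [this]
  rw [IsStationary, StationarySum, this]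

theorem isStationary_dirac (ρ : PMF Γ) {Φ : Γ →* HomeoPlus} {x : ℝ}
    (hx : IsGlobalFixedPoint Φ x) : IsStationary ρ Φ (Measure.dirac x) := by
  ext s hs
  rw [Measure.sum_apply _ hs]
  have : ∀ g, (ρ g • Measure.map (act Φ g) (Measure.dirac x)) s = ρ g * Measure.dirac x s := by
    intro g
    rw [Measure.smul_apply, Measure.map_dirac' (act_measurable Φ g), hx g, smul_eq_mul]
  simp only [this]
  rw [ENNReal.tsum_mul_right, ρ.tsum_coe, one_mul]

theorem IsStationary.smul {ρ : PMF Γ} {Φ : Γ →* HomeoPlus} {ν : Measure ℝ}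
    (h : IsStationary ρ Φ ν) (c : ℝ≥0∞) : IsStationary ρ Φ (c • ν) := by
  ext s hs
  conv_lhs => rw [h]
  rw [Measure.smul_apply, Measure.sum_apply _ hs, Measure.sum_apply _ hs, smul_eq_mul,
    ← ENNReal.tsum_mul_left]
  refine tsum_congr fun g => ?_
  rw [Measure.smul_apply, Measure.smul_apply, Measure.map_apply (act_measurable Φ g) hs,
    Measure.map_apply (act_measurable Φ g) hs, Measure.smul_apply]
  simp only [smul_eq_mul]
  ring

theorem IsStationary.map {ρ : PMF Γ} {Φ Ψ : Γ →* HomeoPlus} {ν : Measure ℝ}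
    (h : IsStationary ρ Φ ν) {φ : ℝ ≃ₜ ℝ} (hφ : IsConjugacy φ Φ Ψ) :
    IsStationary ρ Ψ (Measure.map φ ν) := by
  have hm : Measurable φ := φ.continuous.measurable
  ext s hs
  rw [Measure.map_apply hm hs]
  conv_lhs => rw [h]
  rw [Measure.sum_apply _ (hm hs), Measure.sum_apply _ hs]
  refine tsum_congr fun g => ?_
  rw [Measure.smul_apply, Measure.smul_apply, Measure.map_apply (act_measurable Φ g) (hm hs),
    Measure.map_apply (act_measurable Ψ g) hs, Measure.map_apply hm (act_measurable Ψ g hs)]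
  congr 2
  ext x
  simp only [Set.mem_preimage, hφ g x]

theorem IsConjugacy.symm {Φ Ψ : Γ →* HomeoPlus} {φ : ℝ ≃ₜ ℝ} (hφ : IsConjugacy φ Φ Ψ) :
    IsConjugacy φ.symm Ψ Φ := fun g x => by
  rw [φ.symm_apply_eq, hφ, φ.apply_symm_apply]

theorem IsConjugacy.not_isGlobalFixedPoint {Φ Ψ : Γ →* HomeoPlus} {φ : ℝ ≃ₜ ℝ}
    (hφ : IsConjugacy φ Φ Ψ) (hfix : ∀ x, ¬ IsGlobalFixedPoint Φ x) (x : ℝ) :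
    ¬ IsGlobalFixedPoint Ψ x := fun hx => hfix (φ.symm x) fun g => by
  rw [← hφ.symm g x, hx g]

theorem strictMono_or_strictAnti (φ : ℝ ≃ₜ ℝ) : StrictMono φ ∨ StrictAnti φ :=
  φ.continuous.strictMono_of_inj φ.injective

theorem strictMono_conj (φ : ℝ ≃ₜ ℝ) {f : ℝ → ℝ} (hf : StrictMono f) :
    StrictMono fun x => φ (f (φ.symm x)) := by
  rcases strictMono_or_strictAnti φ with h | h
  · intro x y hxy
    refine h (hf ?_)
    rwa [← h.lt_iff_lt, φ.apply_symm_apply, φ.apply_symm_apply]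
  · intro x y hxy
    refine h (hf ?_)
    rwa [← h.lt_iff_gt, φ.apply_symm_apply, φ.apply_symm_apply]

/-- The conjugate of an action by a homeomorphism of the line. -/
def conjAction (φ : ℝ ≃ₜ ℝ) (Φ : Γ →* HomeoPlus) : Γ →* HomeoPlus :=
  ((MulAut.conj φ).toMonoidHom.comp (HomeoPlus.subtype.comp Φ)).codRestrict HomeoPlus
    fun g => strictMono_conj φ (act_strictMono Φ g)

theorem isConjugacy_conjAction (φ : ℝ ≃ₜ ℝ) (Φ : Γ →* HomeoPlus) :
    IsConjugacy φ Φ (conjAction φ Φ) := fun g x => by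
  change φ (act Φ g x) = φ (act Φ g (φ.symm (φ x)))
  rw [φ.symm_apply_apply]

theorem isLocallyFiniteMeasure_map_symm (φ : ℝ ≃ₜ ℝ) :
    IsLocallyFiniteMeasure (Measure.map φ.symm (volume : Measure ℝ)) := by
  refine ⟨fun x => ⟨φ ⁻¹' Metric.ball (φ x) 1,
    φ.continuous.continuousAt.preimage_mem_nhds (Metric.ball_mem_nhds _ one_pos), ?_⟩⟩
  rw [Measure.map_apply φ.symm.continuous.measurable
    (φ.continuous.measurable Metric.isOpen_ball.measurableSet), ← Set.preimage_comp]
  simp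

theorem map_symm_ne_zero (φ : ℝ ≃ₜ ℝ) : Measure.map φ.symm (volume : Measure ℝ) ≠ 0 := by
  intro h
  have h1 : Measure.map φ.symm (volume : Measure ℝ) Set.univ = 0 := by rw [h]; simp
  rw [Measure.map_apply φ.symm.continuous.measurable MeasurableSet.univ] at h1
  simp at h1

/-- The sign `σ` is the orientation of `φ`, which may be reversing. -/
theorem exists_sign_map_symm (φ : ℝ ≃ₜ ℝ) : ∃ σ : ℝ, σ ≠ 0 ∧
    ∀ x y, x ≤ y → 0 ≤ σ * (φ y - φ x) ∧
      Measure.map φ.symm volume (Set.Icc x y) = ENNReal.ofReal (σ * (φ y - φ x)) := by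
  rcases strictMono_or_strictAnti φ with h | h
  · refine ⟨1, one_ne_zero, fun x y hxy => ⟨by simpa using h.monotone hxy, ?_⟩⟩
    rw [Measure.map_apply φ.symm.continuous.measurable measurableSet_Icc, one_mul,
      ← Real.volume_Icc]
    congr 1
    ext z
    simp only [Set.mem_preimage, Set.mem_Icc]
    rw [← h.le_iff_le, ← h.le_iff_le (a := φ.symm z), φ.apply_symm_apply]
  · refine ⟨-1, by norm_num, fun x y hxy => ⟨by simpa using h.antitone hxy, ?_⟩⟩
    rw [Measure.map_apply φ.symm.continuous.measurable measurableSet_Icc,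
      show -1 * (φ y - φ x) = φ x - φ y by ring, ← Real.volume_Icc]
    congr 1
    ext z
    simp only [Set.mem_preimage, Set.mem_Icc]
    have h1 : φ y ≤ φ (φ.symm z) ↔ φ.symm z ≤ y := h.le_iff_ge
    have h2 : φ (φ.symm z) ≤ φ x ↔ x ≤ φ.symm z := h.le_iff_ge
    rw [← h1, ← h2, φ.apply_symm_apply, and_comm]

theorem IsMinimal.not_hasDiscreteOrbit {Φ : Γ →* HomeoPlus} (hmin : IsMinimal Φ) (x : ℝ) :
    ¬ HasDiscreteOrbit Φ x := by
  intro h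
  obtain ⟨y, hy, hyo⟩ := ((hmin x).sdiff_finite (h 0 1)).exists_mem_open isOpen_Ioo
    (Set.nonempty_Ioo.2 (zero_lt_one' ℝ))
  exact hy.2 ⟨hy.1, Set.Ioo_subset_Icc_self hyo⟩

/-- The points around which the primitive is locally constant form an invariant set. If it contains
an interval, minimality makes it the whole line, and `ν` is locally null. -/
theorem StationarySum.strictMono_primitive {Φ : Γ →* HomeoPlus} {S : Finset Γ} {w : Γ → ℝ}
    {ν : Measure ℝ} [IsLocallyFiniteMeasure ν] (hst : StationarySum Φ S w ν)
    (hw : SymmWeight S w) (hν : ν ≠ 0) (hmin : IsMinimal Φ) : StrictMono (primitive ν) := by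
  intro x y hxy
  refine lt_of_le_of_ne (primitive_mono ν hxy.le) fun heq => hν ?_
  rw [← Measure.measure_univ_eq_zero]
  refine measure_null_of_locally_null _ fun z _ => ?_
  obtain ⟨_, ⟨g, rfl⟩, hgz⟩ := (hmin z).exists_mem_open isOpen_Ioo (Set.nonempty_Ioo.2 hxy)
  obtain ⟨a, b, haz, hzb, hab⟩ := (hw.mem_iff_act_mem (Φ := Φ)
    (Z := {z | ∃ a b, a < z ∧ z < b ∧ primitive ν a = primitive ν b})
    (fun k hk z ⟨a, b, haz, hzb, hab⟩ => by
      refine ⟨act Φ k a, act Φ k b, act_strictMono Φ k haz, act_strictMono Φ k hzb,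
        le_antisymm (primitive_mono ν ((act_strictMono Φ k).monotone (haz.trans hzb).le)) ?_⟩
      have h1 := weight_mul_sub_le hw (primitive_mono ν) (hst.avg_primitive hw) hk
        (haz.trans hzb).le
      rw [hab, sub_self] at h1
      have h2 := (mul_nonpos_iff_pos_imp_nonpos.1 h1).1 (hw.pos k hk)
      linarith) g z).2 ⟨x, y, hgz.1, hgz.2, heq⟩
  refine ⟨Set.Ioo a b, mem_nhdsWithin_of_mem_nhds (Ioo_mem_nhds haz hzb),
    measure_mono_null Set.Ioo_subset_Ico_self ?_⟩
  have := primitive_sub ν (haz.trans hzb).le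
  rw [hab, sub_self] at this
  exact (measureReal_eq_zero_iff (measure_Ico_ne_top ν a b)).1 this.symm

/-- A stationary measure of a minimal action gives a conjugacy to a harmonic action. -/
theorem StationarySum.exists_homeomorph {Φ : Γ →* HomeoPlus} {S : Finset Γ} {w : Γ → ℝ}
    {ν : Measure ℝ} [IsLocallyFiniteMeasure ν] (hst : StationarySum Φ S w ν)
    (hw : SymmWeight S w) (hν : ν ≠ 0) (hmin : IsMinimal Φ) :
    ∃ φ : ℝ ≃ₜ ℝ, StrictMono φ ∧ Measure.map φ ν = volume := by
  have hdisc := hmin.not_hasDiscreteOrbit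
  have hfix : ∀ x, ¬ IsGlobalFixedPoint Φ x := fun x hx => hdisc x hx.hasDiscreteOrbit
  have hmono := hst.strictMono_primitive hw hν hmin
  have hsurj := (continuous_primitive (hst.measure_singleton_eq_zero hw hν hdisc)).surjective
    (hst.tendsto_primitive_atTop hw hfix hν) (hst.tendsto_primitive_atBot hw hfix hν)
  set e := hmono.orderIsoOfSurjective _ hsurj
  have he : ∀ x, e x = primitive ν x := fun _ => rfl
  refine ⟨e.toHomeomorph, hmono, (Measure.ext_of_Ico _ _ fun a b hab => ?_).symm⟩
  have h1 : (e.toHomeomorph : ℝ → ℝ) ⁻¹' Set.Ico a b = Set.Ico (e.symm a) (e.symm b) :=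
    e.preimage_Ico a b
  have h2 := primitive_sub ν (e.symm.monotone hab.le)
  rw [← he, ← he, e.apply_symm_apply, e.apply_symm_apply] at h2
  rw [Measure.map_apply e.toHomeomorph.continuous.measurable measurableSet_Ico, h1,
    Real.volume_Ico, h2, Measure.real, ENNReal.ofReal_toReal (measure_Ico_ne_top ν _ _)]

end LineAction

theorem theoremc {Γ : Type*} [Group Γ] (ρ : PMF Γ)
    (hfin : ρ.support.Finite)
    (hsymm : ∀ g, ρ g⁻¹ = ρ g)
    (hgen : Subgroup.closure ρ.support = ⊤)
    (Φ : Γ →* HomeoPlus) :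
    -- existence of a nonzero stationary Radon measure
    (∃ ν : Measure ℝ, IsLocallyFiniteMeasure ν ∧ ν ≠ 0 ∧ LineAction.IsStationary ρ Φ ν) ∧
    -- its uniqueness up to a scalar factor when there is no discrete orbit
    ((∀ x, ¬ LineAction.HasDiscreteOrbit Φ x) →
      ∀ ν₁ ν₂ : Measure ℝ,
        IsLocallyFiniteMeasure ν₁ → ν₁ ≠ 0 → LineAction.IsStationary ρ Φ ν₁ →
        IsLocallyFiniteMeasure ν₂ → ν₂ ≠ 0 → LineAction.IsStationary ρ Φ ν₂ →
        ∃ c : ℝ≥0, 0 < c ∧ ν₂ = c • ν₁) ∧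
    (LineAction.IsMinimal Φ →
      -- a minimal action is topologically conjugate to a harmonic one
      (∃ φ ∈ HomeoPlus, ∃ Ψ : Γ →* HomeoPlus,
        LineAction.IsConjugacy φ Φ Ψ ∧ LineAction.IsHarmonic ρ Ψ) ∧
      -- and the conjugacy is unique up to post-composition with an affine map
      (∀ (φ : ℝ ≃ₜ ℝ) (Ψ : Γ →* HomeoPlus),
        LineAction.IsConjugacy φ Φ Ψ → LineAction.IsHarmonic ρ Ψ →
        ∀ φ' : ℝ ≃ₜ ℝ,
          (∃ Ψ' : Γ →* HomeoPlus, LineAction.IsConjugacy φ' Φ Ψ' ∧ LineAction.IsHarmonic ρ Ψ') ↔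
            ∃ a b : ℝ, a ≠ 0 ∧ ∀ x, φ' x = a * φ x + b)) := by
  have hw := LineAction.symmWeight_of_pmf hfin hsymm hgen
  have hiff := LineAction.isStationary_iff hfin Φ
  have hex : ∃ ν : Measure ℝ, IsLocallyFiniteMeasure ν ∧ ν ≠ 0 ∧
      LineAction.IsStationary ρ Φ ν := by
    by_cases hfix : ∃ x, LineAction.IsGlobalFixedPoint Φ x
    · obtain ⟨x, hx⟩ := hfix
      exact ⟨Measure.dirac x, inferInstance, NeZero.ne _, LineAction.isStationary_dirac ρ hx⟩
    · push Not at hfix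
      obtain ⟨ν, hν, hν0, hst⟩ := LineAction.exists_stationarySum hw hfix
      exact ⟨ν, hν, hν0, (hiff ν).2 hst⟩
  have huniq : (∀ x, ¬ LineAction.HasDiscreteOrbit Φ x) →
      ∀ ν₁ ν₂ : Measure ℝ,
        IsLocallyFiniteMeasure ν₁ → ν₁ ≠ 0 → LineAction.IsStationary ρ Φ ν₁ →
        IsLocallyFiniteMeasure ν₂ → ν₂ ≠ 0 → LineAction.IsStationary ρ Φ ν₂ →
        ∃ c : ℝ≥0, 0 < c ∧ ν₂ = c • ν₁ := fun hdisc ν₁ ν₂ _ h₁ hs₁ _ h₂ hs₂ =>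
    ((hiff ν₁).1 hs₁).exists_eq_smul hw ((hiff ν₂).1 hs₂) h₁ h₂ hdisc
  refine ⟨hex, huniq, fun hmin => ?_⟩
  have hdisc := hmin.not_hasDiscreteOrbit
  have hfix : ∀ x, ¬ LineAction.IsGlobalFixedPoint Φ x := fun x hx => hdisc x hx.hasDiscreteOrbit
  refine ⟨?_, fun φ Ψ hφ hΨ φ' => ⟨?_, ?_⟩⟩
  · obtain ⟨ν, _, hν, hst⟩ := hex
    obtain ⟨φ, hφ, hmap⟩ := ((hiff ν).1 hst).exists_homeomorph hw hν hmin
    have hc := LineAction.isConjugacy_conjAction φ Φ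
    exact ⟨φ, hφ, LineAction.conjAction φ Φ, hc, hc.not_isGlobalFixedPoint hfix,
      hmap ▸ hst.map hc⟩
  · rintro ⟨Ψ', hφ', hΨ'⟩
    -- Lebesgue measure pulled back by `φ` and by `φ'` gives two stationary measures of the same
    -- action, hence proportional ones.
    obtain ⟨c, hc, heq⟩ := huniq hdisc _ _ (LineAction.isLocallyFiniteMeasure_map_symm φ)
      (LineAction.map_symm_ne_zero φ) (hΨ.stationary_lebesgue.map hφ.symm)
      (LineAction.isLocallyFiniteMeasure_map_symm φ') (LineAction.map_symm_ne_zero φ')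
      (hΨ'.stationary_lebesgue.map hφ'.symm)
    obtain ⟨σ, hσ, h⟩ := LineAction.exists_sign_map_symm φ
    obtain ⟨σ', hσ', h'⟩ := LineAction.exists_sign_map_symm φ'
    have key : ∀ x y, x ≤ y → σ' * (φ' y - φ' x) = c * (σ * (φ y - φ x)) := by
      intro x y hxy
      have h1 := (h' x y hxy).2
      rw [heq, Measure.smul_apply, (h x y hxy).2, ENNReal.smul_def, smul_eq_mul,
        ← ENNReal.ofReal_coe_nnreal, ← ENNReal.ofReal_mul c.coe_nonneg] at h1
      exact ((ENNReal.ofReal_eq_ofReal_iff (mul_nonneg c.coe_nonneg (h x y hxy).1)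
        (h' x y hxy).1).1 h1).symm
    refine ⟨c * σ / σ', φ' 0 - c * σ / σ' * φ 0,
      div_ne_zero (mul_ne_zero (NNReal.coe_ne_zero.2 hc.ne') hσ) hσ', fun x => ?_⟩
    have h2 : σ' * (φ' x - φ' 0) = c * (σ * (φ x - φ 0)) := by
      rcases le_total 0 x with hx | hx
      · exact key 0 x hx
      · linarith [key x 0 hx]
    field_simp
    linarith
  · rintro ⟨a, b, ha, hab⟩
    have hc := LineAction.isConjugacy_conjAction φ' Φ
    refine ⟨LineAction.conjAction φ' Φ, hc, hc.not_isGlobalFixedPoint hfix, ?_⟩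
    -- The factor `|a|` compensates the scaling of Lebesgue measure under `y ↦ a * y`.
    have h1 := ((hΨ.stationary_lebesgue.map hφ.symm).map hc).smul (ENNReal.ofReal |a|)
    have h2 : (φ' : ℝ → ℝ) ∘ φ.symm = (fun y => y + b) ∘ fun y => a * y := by
      ext y
      simp [hab]
    rw [Measure.map_map φ'.continuous.measurable φ.symm.continuous.measurable, h2,
      ← Measure.map_map (measurable_add_const b) (measurable_const_mul a), ← Measure.map_smul,
      Real.smul_map_volume_mul_left ha, map_add_right_eq_self] at h1
    exact h1
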